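/- Let $K$ be a field of characteristic $3$ with a derivation $\delta:K\to K$ (an additive map with $\delta(ab)=a\delta(b)+\delta(a)b$), and let $F=\{a\in K \mid \delta(a)=0\}$ be its field of constants. Assume that $\delta$, as an $F$-linear endomorphism of $K$, has minimum polynomial $g(t)=t^3-ct\in F[t]$ with $c\in F$. Let $K[t;\delta]$ be the differential polynomial ring, whose elements are the polynomials $\sum_i a_it^i$ with $a_i\in K$, multiplied by the rule $ta=at+\delta(a)$ for $a\in K$. Let $d\in K\setminus F$ and $f=t^3-ct-d\in K[t;\delta]$. Let $(K,\delta,d)=S_f$ be the set $\{h\in K[t;\delta]\mid \deg h<3\}$ with the usual addition and the multiplication $h\circ k=$ the remainder $r$ of $hk$ under right division by $f$ (that is, $hk=qf+r$ with $\deg r<3$); it is a unital, not necessarily associative $F$-algebra containing $K$ as the constant polynomials. Then: 1. $(K,\delta,d)$ has dimension $9$ over $F$, is not associative, and is a division algebra (it is nonzero, and left and right multiplication with any nonzero element are bijective). 2. Its left nucleus and its middle nucleus are equal to $K$, and its right nucleus contains $K$. (With $[x,y,z]=(xy)z-x(yz)$, these nuclei of an algebra $A$ are the sets of those $x\in A$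 with $[x,A,A]=0$, $[A,x,A]=0$ and $[A,A,x]=0$, respectively.) 3. Put $V(a)=a^3+\delta^2(a)-ca$ for $a\in K$. The set $\{\delta(b)/b\mid b\in K,\ b\neq 0\}$ is an additive subgroup of $K$ and equals $\{a\in K\mid V(a)=0\}$. For each $a\in K$ with $V(a)=0$ the map $G_{\mathrm{id},-a}:\sum_i a_it^i\mapsto\sum_i a_i(t-a)^i$ is an $F$-algebra automorphism of $(K,\delta,d)$; the set $\{G_{\mathrm{id},-a}\mid a\in K,\ V(a)=0\}$ is a subgroup of $\mathrm{Aut}_F((K,\delta,d))$; and $a\mapsto G_{\mathrm{id},-a}$ is a group isomorphism from the additive group $\{\delta(b)/b\mid b\in K,\ b\neq0\}$ onto this subgroup. -/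

import Mathlib

open Polynomial

noncomputable section

/-- The field of constants `{a ∈ K | δ a = 0}` of a derivation `δ` of the field `K`. -/
def constField {K : Type*} [Field K] (δ : Derivation ℤ K K) : Subfield K where
  carrier := {a | δ a = 0}
  mul_mem' {a b} ha hb := by
    have ha' : δ a = 0 := ha
    have hb' : δ b = 0 := hb
    show δ (a * b) = 0
    rw [Derivation.leibniz, ha', hb']; simp
  one_mem' := δ.map_one_eq_zero
  add_mem' {a b} ha hb := by
    have ha' : δ a = 0 := ha
    have hb' : δ b = 0 := hb
    show δ (a + b) = 0
    rw [map_add, ha', hb', add_zero]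
  zero_mem' := map_zero δ
  neg_mem' {a} ha := by
    have ha' : δ a = 0 := ha
    show δ (-a) = 0
    rw [map_neg, ha', neg_zero]
  inv_mem' a ha := by
    have ha' : δ a = 0 := ha
    show δ a⁻¹ = 0
    rw [Derivation.leibniz_inv, ha', smul_zero]

/-- The derivation `δ`, as an endomorphism of the vector space `K` over the field of
constants. -/
def derivationEnd {K : Type*} [Field K] (δ : Derivation ℤ K K) :
    Module.End (constField δ) K where
  toFun := δ
  map_add' := map_add δ
  map_smul' a x := by
    have ha : δ (a : K) = 0 := a.2
    show δ ((a : K) * x) = (a : K) * δ x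
    rw [Derivation.leibniz, ha]; simp

/-! ### The differential polynomial ring `K[t; δ]` -/

/-- The differential polynomial ring `K[t; δ]`. The polynomial with coefficients `aᵢ` represents
`∑ aᵢ tⁱ`, with the coefficients on the left; addition is that of polynomials, and the
multiplication is the one with `t a = a t + δ a` (see `DiffPoly.instRing`). -/
def DiffPoly {K : Type*} [Field K] (_δ : Derivation ℤ K K) : Type _ := K[X]

namespace DiffPoly

variable {K : Type*} [Field K] (δ : Derivation ℤ K K)

instance instAddCommGroup : AddCommGroup (DiffPoly δ) := inferInstanceAs (AddCommGroup K[X])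

instance instModule : Module K (DiffPoly δ) := inferInstanceAs (Module K K[X])

/-- The differential polynomial with a given sequence of coefficients. -/
def ofPoly : K[X] ≃ₗ[K] DiffPoly δ := LinearEquiv.refl K K[X]

/-- The sequence of (left) coefficients of a differential polynomial. -/
def toPoly : DiffPoly δ ≃ₗ[K] K[X] := LinearEquiv.refl K K[X]

/-- Application of `δ` to all coefficients. -/
def coeffDer : K[X] →+ K[X] where
  toFun p := p.sum fun i a => monomial i (δ a)
  map_zero' := by simp
  map_add' p q := Polynomial.sum_add_index _ _ _ (by simp) (by simp)

/-- Left multiplication by `t`, that is `∑ aᵢ tⁱ ↦ ∑ (aᵢ tⁱ⁺¹ + δ(aᵢ) tⁱ)`. -/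
def tMul : AddMonoid.End K[X] := AddMonoidHom.mulRight X + coeffDer δ

/-- Left multiplication by the constant `a`, that is `∑ aᵢ tⁱ ↦ ∑ (a aᵢ) tⁱ`. -/
def coeffMul (a : K) : AddMonoid.End K[X] := AddMonoidHom.mulLeft (C a)

@[simp] theorem coeffMul_apply (a : K) (p : K[X]) : coeffMul a p = C a * p := rfl

theorem end_mul_apply (S T : AddMonoid.End K[X]) (p : K[X]) : (S * T) p = S (T p) := rfl

theorem end_add_apply (S T : AddMonoid.End K[X]) (p : K[X]) : (S + T) p = S p + T p := rfl

/-- Left multiplication by `∑ aᵢ tⁱ`, that is `q ↦ ∑ aᵢ (t (t (⋯ (t q))))`. -/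
def act (p : K[X]) : AddMonoid.End K[X] :=
  p.sum (S := AddMonoid.End K[X]) fun i a => coeffMul a * tMul δ ^ i

variable {δ}

theorem coeffDer_monomial (i : ℕ) (a : K) : coeffDer δ (monomial i a) = monomial i (δ a) := by
  show (monomial i a).sum (fun i a => monomial i (δ a)) = _
  rw [Polynomial.sum_monomial_index]; simp

theorem tMul_monomial (i : ℕ) (a : K) :
    tMul δ (monomial i a) = monomial (i + 1) a + monomial i (δ a) := by
  show monomial i a * X + coeffDer δ _ = _
  rw [coeffDer_monomial, monomial_mul_X]

theorem act_add (p q : K[X]) : act δ (p + q) = act δ p + act δ q := by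
  refine Polynomial.sum_add_index _ _ _ (fun i => ?_) (fun i a b => ?_)
  · ext q; simp
  · ext1 q; simp only [end_add_apply, end_mul_apply, coeffMul_apply, C_add, add_mul]

theorem act_monomial (i : ℕ) (a : K) : act δ (monomial i a) =
    coeffMul a * tMul δ ^ i := by
  unfold act
  rw [Polynomial.sum_monomial_index]
  ext q; simp

theorem act_zero : act δ 0 = 0 := by simp [act]

theorem act_one : act δ 1 = 1 := by
  rw [← monomial_zero_one, act_monomial]
  ext1 q; simp

theorem tMul_pow_one (i : ℕ) : (tMul δ ^ i) 1 = monomial i 1 := by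
  induction i with
  | zero => simp
  | succ i ih =>
    rw [pow_succ', end_mul_apply, ih, tMul_monomial]; simp

theorem act_apply_one (p : K[X]) : act δ p 1 = p := by
  induction p using Polynomial.induction_on' with
  | add p q hp hq => rw [act_add, end_add_apply, hp, hq]
  | monomial i a =>
    rw [act_monomial, end_mul_apply, tMul_pow_one]
    simp [C_mul_monomial]

theorem act_C_mul (a : K) (q : K[X]) :
    act δ (C a * q) = coeffMul a * act δ q := by
  induction q using Polynomial.induction_on' with
  | add p q hp hq => rw [mul_add, act_add, act_add, hp, hq, mul_add]
  | monomial i b =>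
    rw [C_mul_monomial, act_monomial, act_monomial]
    ext1 q; simp [mul_assoc]

theorem tMul_C_mul (b : K) (q : K[X]) :
    tMul δ (C b * q) = C b * tMul δ q + C (δ b) * q := by
  induction q using Polynomial.induction_on' with
  | add p q hp hq => rw [mul_add, map_add, map_add, hp, hq]; ring
  | monomial i a =>
    simp only [C_mul_monomial, tMul_monomial, mul_add, Derivation.leibniz, smul_eq_mul, map_add]
    rw [mul_comm a (δ b)]; abel

theorem act_tMul (q : K[X]) :
    act δ (tMul δ q) = tMul δ * act δ q := by
  induction q using Polynomial.induction_on' with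
  | add p q hp hq => rw [map_add, act_add, act_add, hp, hq, mul_add]
  | monomial i b =>
    rw [tMul_monomial, act_add, act_monomial, act_monomial, act_monomial]
    ext1 q
    simp only [end_add_apply, end_mul_apply, coeffMul_apply,
      tMul_C_mul, pow_succ']

theorem act_act (p q : K[X]) : act δ (act δ p q) = act δ p * act δ q := by
  induction p using Polynomial.induction_on' with
  | add p r hp hr => rw [act_add, end_add_apply, act_add, hp, hr, add_mul]
  | monomial i a =>
    have h : ∀ i : ℕ, act δ ((tMul δ ^ i) q) =
        tMul δ ^ i * act δ q := by
      intro i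
      induction i with
      | zero => simp
      | succ i ih =>
        rw [pow_succ', end_mul_apply, act_tMul, ih, mul_assoc]
    rw [act_monomial, end_mul_apply, coeffMul_apply, act_C_mul, h, mul_assoc]

/-- `(∑ aᵢ tⁱ) q = ∑ aᵢ (t (t (⋯ (t q))))`, where `t (∑ bⱼ tʲ) = ∑ (bⱼ tʲ⁺¹ + δ(bⱼ) tʲ)`. -/
instance instRing : Ring (DiffPoly δ) :=
  { instAddCommGroup δ with
    mul := fun p q => ofPoly δ (act δ (toPoly δ p) (toPoly δ q))
    one := ofPoly δ 1
    left_distrib := fun p q r => map_add (act δ p) q r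
    right_distrib := fun p q r =>
      congrArg (fun S : AddMonoid.End K[X] => S (toPoly δ r)) (act_add (toPoly δ p) (toPoly δ q))
    zero_mul := fun p => congrArg (fun S : AddMonoid.End K[X] => S (toPoly δ p)) (act_zero (δ := δ))
    mul_zero := fun p => map_zero (act δ p)
    mul_assoc := fun p q r =>
      congrArg (fun S : AddMonoid.End K[X] => S (toPoly δ r)) (act_act (toPoly δ p) (toPoly δ q))
    one_mul := fun p => congrArg (fun S : AddMonoid.End K[X] => S (toPoly δ p)) (act_one (δ := δ))
    mul_one := fun p => act_apply_one p
    zsmul := (instAddCommGroup δ).zsmul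
    zsmul_zero' := (instAddCommGroup δ).zsmul_zero'
    zsmul_succ' := (instAddCommGroup δ).zsmul_succ'
    zsmul_neg' := (instAddCommGroup δ).zsmul_neg'
    nsmul := (instAddCommGroup δ).nsmul
    nsmul_zero := (instAddCommGroup δ).nsmul_zero
    nsmul_succ := (instAddCommGroup δ).nsmul_succ }

variable (δ) in
/-- The indeterminate `t`. -/
def t : DiffPoly δ := ofPoly δ X

variable (δ) in
/-- The constant polynomials, `K ⊆ K[t; δ]`. -/
def const : K →+* DiffPoly δ where
  toFun a := ofPoly δ (C a)
  map_one' := rfl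
  map_zero' := C_0
  map_add' _ _ := C_add
  map_mul' a b := by
    show C (a * b) = act δ (C a) (C b)
    rw [C_mul, ← monomial_zero_left, act_monomial]; simp

theorem const_mul (a : K) (p : DiffPoly δ) : const δ a * p = a • p := by
  show act δ (C a) (toPoly δ p) = a • (toPoly δ p)
  rw [← monomial_zero_left, act_monomial]; simp [smul_eq_C_mul]

/-- The defining relation of `K[t; δ]`. -/
theorem t_mul_const (a : K) : t δ * const δ a = const δ a * t δ + const δ (δ a) := by
  rw [const_mul]
  show act δ X (C a) = a • (X : K[X]) + C (δ a)
  rw [← monomial_one_one_eq_X, act_monomial, ← monomial_zero_left, pow_one,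
    end_mul_apply, tMul_monomial]
  simp [smul_monomial]

/-- Every differential polynomial is the sum of its terms `aᵢ tⁱ`. -/
theorem eq_sum (p : DiffPoly δ) :
    p = (toPoly δ p).sum fun i a => const δ a * t δ ^ i := by
  have ht : ∀ i : ℕ, t δ ^ i = ofPoly δ (monomial i 1) := by
    intro i
    induction i with
    | zero => rfl
    | succ i ih =>
      rw [pow_succ', ih]
      show act δ X (monomial i 1) = monomial (i + 1) 1
      rw [← monomial_one_one_eq_X, act_monomial, pow_one, end_mul_apply, tMul_monomial]
      simp
  have h : ∀ (i : ℕ) (a : K), const δ a * t δ ^ i = ofPoly δ (monomial i a) := by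
    intro i a
    rw [const_mul, ht, ← map_smul, smul_monomial, smul_eq_mul, mul_one]
  simp only [h]
  have := map_sum (ofPoly δ) (fun i => monomial i ((toPoly δ p).coeff i)) (toPoly δ p).support
  rw [Polynomial.sum, ← this]
  have h2 := (toPoly δ p).sum_monomial_eq
  rw [Polynomial.sum] at h2
  rw [h2]; rfl

/-- The map `G_{id, b} : ∑ aᵢ tⁱ ↦ ∑ aᵢ (t + b)ⁱ` on `K[t; δ]`. -/
def translate (b : K) (p : DiffPoly δ) : DiffPoly δ :=
  (toPoly δ p).sum fun i a => const δ a * (t δ + const δ b) ^ i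

/-! ### Right division with remainder -/

theorem degree_coeffDer_le (p : K[X]) : (coeffDer δ p).degree ≤ p.degree := by
  refine (degree_sum_le _ _).trans (Finset.sup_le fun i hi => ?_)
  exact (degree_monomial_le _ _).trans (le_degree_of_mem_supp i hi)

theorem tMul_degree_leadingCoeff (p : K[X]) :
    (tMul δ p).degree = p.degree + 1 ∧ (tMul δ p).leadingCoeff = p.leadingCoeff := by
  by_cases hp : p = 0
  · subst hp; simp
  have h1 : (p * X).degree = p.degree + 1 := by rw [degree_mul, degree_X]
  have h2 : (coeffDer δ p).degree < (p * X).degree := by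
    refine (degree_coeffDer_le p).trans_lt ?_
    rw [h1, degree_eq_natDegree hp]
    exact_mod_cast Nat.lt_succ_self _
  have h3 : tMul δ p = p * X + coeffDer δ p := rfl
  rw [h3, degree_add_eq_left_of_degree_lt h2, leadingCoeff_add_of_degree_lt' h2, h1,
    leadingCoeff_mul_X]
  exact ⟨rfl, rfl⟩

theorem act_monomial_degree_leadingCoeff (i : ℕ) {a : K} (ha : a ≠ 0) (p : K[X]) :
    (act δ (monomial i a) p).degree = i + p.degree ∧
      (act δ (monomial i a) p).leadingCoeff = a * p.leadingCoeff := by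
  have h : ((tMul δ ^ i : AddMonoid.End K[X]) p).degree = i + p.degree ∧
      ((tMul δ ^ i : AddMonoid.End K[X]) p).leadingCoeff = p.leadingCoeff := by
    induction i with
    | zero => simp
    | succ i ih =>
      rw [pow_succ', end_mul_apply, (tMul_degree_leadingCoeff _).1,
        (tMul_degree_leadingCoeff _).2, ih.1, ih.2]
      refine ⟨?_, rfl⟩
      push_cast
      rw [add_assoc, add_comm p.degree 1, add_assoc]
  rw [act_monomial, end_mul_apply, coeffMul_apply, degree_C_mul ha, leadingCoeff_mul,
    leadingCoeff_C, h.1, h.2]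
  exact ⟨rfl, rfl⟩

theorem degree_act_le (p q : K[X]) : (act δ p q).degree ≤ p.degree + q.degree := by
  have h : act δ p q = ∑ i ∈ p.support, act δ (monomial i (p.coeff i)) q := by
    conv_lhs => rw [← p.sum_monomial_eq]
    rw [Polynomial.sum]
    induction p.support using Finset.induction_on with
    | empty => rw [Finset.sum_empty, Finset.sum_empty, act_zero]; rfl
    | insert i s hi ih => rw [Finset.sum_insert hi, Finset.sum_insert hi, act_add, end_add_apply, ih]
  rw [h]
  refine (degree_sum_le _ _).trans (Finset.sup_le fun i hi => ?_)
  rw [(act_monomial_degree_leadingCoeff i (mem_support_iff.mp hi) q).1]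
  gcongr
  exact le_degree_of_mem_supp i hi

theorem degree_act (p q : K[X]) : (act δ p q).degree = p.degree + q.degree := by
  by_cases hp : p = 0
  · subst hp; rw [act_zero]; simp
  by_cases hq : q = 0
  · subst hq; simp
  have h1 : act δ p q =
      act δ p.eraseLead q + act δ (monomial p.natDegree p.leadingCoeff) q := by
    rw [← end_add_apply, ← act_add, eraseLead_add_monomial_natDegree_leadingCoeff]
  have h2 := (act_monomial_degree_leadingCoeff (δ := δ) p.natDegree
    (leadingCoeff_ne_zero.mpr hp) q).1
  rw [← degree_eq_natDegree hp] at h2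
  rw [h1, degree_add_eq_right_of_degree_lt, h2]
  rw [h2]
  refine (degree_act_le _ _).trans_lt ?_
  have h3 := degree_eraseLead_lt hp
  rw [degree_eq_natDegree hq]
  exact WithBot.add_lt_add_right (WithBot.coe_ne_bot) h3

theorem exists_division {f : K[X]} (hf : f ≠ 0) (g : K[X]) :
    ∃ q r : K[X], g = act δ q f + r ∧ r.degree < f.natDegree := by
  induction hn : g.natDegree using Nat.strong_induction_on generalizing g with
  | _ n ih =>
    by_cases hg : g.degree < f.natDegree
    · exact ⟨0, g, by rw [act_zero]; exact (zero_add g).symm, hg⟩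
    have hg0 : g ≠ 0 := by
      rintro rfl
      exact hg (by rw [degree_zero]; exact WithBot.bot_lt_coe _)
    have hle : f.natDegree ≤ g.natDegree := by
      rw [degree_eq_natDegree hg0] at hg
      exact_mod_cast not_lt.mp hg
    have ha : g.leadingCoeff / f.leadingCoeff ≠ 0 :=
      div_ne_zero (leadingCoeff_ne_zero.mpr hg0) (leadingCoeff_ne_zero.mpr hf)
    obtain ⟨h1, h2⟩ := act_monomial_degree_leadingCoeff (δ := δ) (g.natDegree - f.natDegree) ha f
    rw [div_mul_cancel₀ _ (leadingCoeff_ne_zero.mpr hf)] at h2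
    rw [degree_eq_natDegree hf, ← Nat.cast_add, Nat.sub_add_cancel hle,
      ← degree_eq_natDegree hg0] at h1
    have h3 := degree_sub_lt_left h1.symm hg0 h2.symm
    set s := monomial (g.natDegree - f.natDegree) (g.leadingCoeff / f.leadingCoeff)
    by_cases h4 : g - act δ s f = 0
    · exact ⟨s, 0, by rw [add_zero]; exact sub_eq_zero.mp h4,
        by rw [degree_zero]; exact WithBot.bot_lt_coe _⟩
    obtain ⟨q, r, hqr, hr⟩ := ih _ (hn ▸ natDegree_lt_natDegree h4 h3) _ rfl
    refine ⟨s + q, r, ?_, hr⟩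
    rw [act_add, end_add_apply, add_assoc, ← hqr]; abel

/-- The space `R_m` of differential polynomials of degree less than `m = deg f`. -/
def lowDegree (f : DiffPoly δ) : Submodule K (DiffPoly δ) :=
  (degreeLT K (toPoly δ f).natDegree).comap (toPoly δ).toLinearMap

theorem eq_zero_of_mul_mem {f q : DiffPoly δ} (hf : f ≠ 0) (h : q * f ∈ lowDegree f) : q = 0 := by
  have hf' : toPoly δ f ≠ 0 := hf
  have h1 : (act δ (toPoly δ q) (toPoly δ f)).degree < (toPoly δ f).natDegree := mem_degreeLT.mp h
  by_contra hq
  have hq' : toPoly δ q ≠ 0 := hq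
  rw [degree_act, degree_eq_natDegree hf', degree_eq_natDegree hq'] at h1
  have h2 : (toPoly δ q).natDegree + (toPoly δ f).natDegree < (toPoly δ f).natDegree := by
    exact_mod_cast h1
  omega

/-- Right division by `f ≠ 0`: every `g` is `q f + r` with a unique `r` of degree less than
`deg f`. -/
theorem existsUnique_remainder {f : DiffPoly δ} (hf : f ≠ 0) (g : DiffPoly δ) :
    ∃! r : lowDegree f, ∃ q : DiffPoly δ, g = q * f + r := by
  obtain ⟨q, r, hqr, hr⟩ := exists_division (δ := δ) (f := toPoly δ f) hf (toPoly δ g)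
  refine ⟨⟨ofPoly δ r, mem_degreeLT.mpr hr⟩, ⟨ofPoly δ q, hqr⟩, ?_⟩
  rintro ⟨r', hr'⟩ ⟨q', hq'⟩
  have h1 : g = ofPoly δ q * f + ofPoly δ r := hqr
  have h2 : (ofPoly δ q - q') * f = r' - ofPoly δ r := by
    rw [sub_mul, sub_eq_sub_iff_add_eq_add, ← h1, hq', add_comm]
  have h3 : ofPoly δ q - q' = 0 := by
    refine eq_zero_of_mul_mem hf ?_
    rw [h2]
    exact (lowDegree f).sub_mem hr' (mem_degreeLT.mpr hr)
  rw [h3, zero_mul] at h2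
  exact Subtype.ext (sub_eq_zero.mp h2.symm)

open Classical in
/-- The remainder of `g` under right division by `f` (and `0` if `f = 0`). -/
def modR (f g : DiffPoly δ) : lowDegree f :=
  if hf : f = 0 then 0 else (existsUnique_remainder hf g).choose

theorem modR_spec {f : DiffPoly δ} (hf : f ≠ 0) (g : DiffPoly δ) :
    ∃ q : DiffPoly δ, g = q * f + modR f g := by
  rw [modR, dif_neg hf]
  exact (existsUnique_remainder hf g).choose_spec.1

theorem modR_eq {f : DiffPoly δ} (hf : f ≠ 0) {g q : DiffPoly δ} {r : lowDegree f}
    (h : g = q * f + r) : modR f g = r :=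
  (existsUnique_remainder hf g).unique (modR_spec hf g) ⟨q, h⟩

theorem modR_add (f g h : DiffPoly δ) : modR f (g + h) = modR f g + modR f h := by
  by_cases hf : f = 0
  · simp [modR, hf]
  obtain ⟨q, hq⟩ := modR_spec hf g
  obtain ⟨q', hq'⟩ := modR_spec hf h
  refine modR_eq hf (q := q + q') ?_
  conv_lhs => rw [hq, hq']
  rw [add_mul, Submodule.coe_add]; abel

theorem modR_smul (f : DiffPoly δ) (a : K) (g : DiffPoly δ) : modR f (a • g) = a • modR f g := by
  by_cases hf : f = 0
  · simp [modR, hf]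
  obtain ⟨q, hq⟩ := modR_spec hf g
  refine modR_eq hf (q := a • q) ?_
  conv_lhs => rw [hq]
  rw [smul_add, ← const_mul a (q * f), ← mul_assoc, const_mul, Submodule.coe_smul]

theorem modR_coe {f : DiffPoly δ} (r : lowDegree f) : modR f (r : DiffPoly δ) = r := by
  by_cases hf : f = 0
  · subst hf
    have h : toPoly δ (r : DiffPoly δ) ∈ degreeLT K (toPoly δ (0 : DiffPoly δ)).natDegree := r.2
    rw [map_zero, natDegree_zero, mem_degreeLT, Nat.cast_zero, ← not_le, zero_le_degree_iff,
      not_not] at h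
    have h' : r = 0 := Subtype.ext h
    rw [h']; simp [modR]
  · exact modR_eq hf (q := 0) (by rw [zero_mul, zero_add])

theorem modR_zero (f : DiffPoly δ) : modR f 0 = 0 := by
  rw [← zero_smul K (0 : DiffPoly δ), modR_smul, zero_smul]

/-- Constants commute with the elements of `K[t; δ]` if they are killed by `δ`. -/
theorem mul_smul_of_mem (a : K) (ha : a ∈ constField δ) (p q : DiffPoly δ) :
    p * (a • q) = a • (p * q) := by
  have ha' : δ a = 0 := ha
  have h : ∀ i : ℕ, ∀ r : K[X], (tMul δ ^ i : AddMonoid.End K[X]) (C a * r) =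
      C a * (tMul δ ^ i : AddMonoid.End K[X]) r := by
    intro i
    induction i with
    | zero => intro r; rfl
    | succ i ih =>
      intro r
      rw [pow_succ', end_mul_apply, ih, tMul_C_mul, ha', C_0, zero_mul, add_zero, end_mul_apply]
  have h2 : ∀ p r : K[X], act δ p (C a * r) = C a * act δ p r := by
    intro p r
    induction p using Polynomial.induction_on' with
    | add p q hp hq => rw [act_add, end_add_apply, end_add_apply, hp, hq, mul_add]
    | monomial i b =>
      rw [act_monomial, end_mul_apply, end_mul_apply, h, coeffMul_apply, coeffMul_apply]; ring
  have h3 := h2 (toPoly δ p) (toPoly δ q)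
  rw [← smul_eq_C_mul, ← smul_eq_C_mul] at h3
  exact h3

end DiffPoly

/-! ### Petit algebras -/

/-- The Petit algebra `S_f`: the space of differential polynomials of degree less than `deg f`,
with the multiplication `g ∘ h = g h mod_r f`. -/
def PetitAlgebra {K : Type*} [Field K] {δ : Derivation ℤ K K} (f : DiffPoly δ) : Type _ :=
  DiffPoly.lowDegree f

namespace PetitAlgebra

open DiffPoly

variable {K : Type*} [Field K] {δ : Derivation ℤ K K} (f : DiffPoly δ)

instance instAddCommGroup : AddCommGroup (PetitAlgebra f) :=
  inferInstanceAs (AddCommGroup (lowDegree f))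

instance instModule : Module K (PetitAlgebra f) := inferInstanceAs (Module K (lowDegree f))

/-- An element of `S_f`, as a differential polynomial. -/
def toDiffPoly : PetitAlgebra f →ₗ[K] DiffPoly δ := (lowDegree f).subtype

/-- The class of a differential polynomial in `S_f`: its remainder under right division by `f`. -/
def mk : DiffPoly δ →ₗ[K] PetitAlgebra f where
  toFun := modR f
  map_add' := modR_add f
  map_smul' := modR_smul f

theorem mk_toDiffPoly (x : PetitAlgebra f) : mk f (toDiffPoly f x) = x := modR_coe x

theorem eq_zero_of_one_notMem (h : (1 : DiffPoly δ) ∉ lowDegree f) (x : PetitAlgebra f) :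
    x = 0 := by
  have hm : (toPoly δ f).natDegree = 0 := by
    by_contra hm
    refine h (mem_degreeLT.mpr ?_)
    show (1 : K[X]).degree < _
    rw [degree_one]
    exact_mod_cast Nat.pos_of_ne_zero hm
  have hx : toPoly δ (toDiffPoly f x) ∈ degreeLT K (toPoly δ f).natDegree := x.2
  rw [hm, mem_degreeLT, Nat.cast_zero, ← not_le, zero_le_degree_iff, not_not] at hx
  exact Subtype.ext hx

theorem mk_one_mul (g : DiffPoly δ) : mk f (toDiffPoly f (mk f 1) * g) = mk f g := by
  by_cases h : (1 : DiffPoly δ) ∈ lowDegree f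
  · have h1 : toDiffPoly f (mk f 1) = 1 :=
      congrArg Subtype.val (modR_coe (⟨1, h⟩ : lowDegree f))
    rw [h1, one_mul]
  · rw [eq_zero_of_one_notMem f h (mk f g), eq_zero_of_one_notMem f h (mk f _)]

instance instNonAssocRing : NonAssocRing (PetitAlgebra f) :=
  { instAddCommGroup f with
    mul := fun g h => mk f (toDiffPoly f g * toDiffPoly f h)
    one := mk f 1
    left_distrib := fun g h k => by
      show mk f (toDiffPoly f g * toDiffPoly f (h + k)) = mk f _ + mk f _
      rw [map_add, mul_add, map_add]
    right_distrib := fun g h k => by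
      show mk f (toDiffPoly f (g + h) * toDiffPoly f k) = mk f _ + mk f _
      rw [map_add, add_mul, map_add]
    zero_mul := fun g => by
      show mk f (toDiffPoly f 0 * toDiffPoly f g) = 0
      rw [map_zero, zero_mul, map_zero]
    mul_zero := fun g => by
      show mk f (toDiffPoly f g * toDiffPoly f 0) = 0
      rw [map_zero, mul_zero, map_zero]
    one_mul := fun g => by
      show mk f (toDiffPoly f (mk f 1) * toDiffPoly f g) = g
      rw [mk_one_mul, mk_toDiffPoly]
    mul_one := fun g => by
      show mk f (toDiffPoly f g * toDiffPoly f (mk f 1)) = g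
      by_cases h : (1 : DiffPoly δ) ∈ lowDegree f
      · have h1 : toDiffPoly f (mk f 1) = 1 :=
          congrArg Subtype.val (modR_coe (⟨1, h⟩ : lowDegree f))
        rw [h1, mul_one, mk_toDiffPoly]
      · rw [eq_zero_of_one_notMem f h g]
        rw [map_zero, zero_mul, map_zero]
    zsmul := (instAddCommGroup f).zsmul
    zsmul_zero' := (instAddCommGroup f).zsmul_zero'
    zsmul_succ' := (instAddCommGroup f).zsmul_succ'
    zsmul_neg' := (instAddCommGroup f).zsmul_neg'
    nsmul := (instAddCommGroup f).nsmul
    nsmul_zero := (instAddCommGroup f).nsmul_zero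
    nsmul_succ := (instAddCommGroup f).nsmul_succ }

theorem mul_def (g h : PetitAlgebra f) : g * h = mk f (toDiffPoly f g * toDiffPoly f h) := rfl

/-- Constants of `δ` can be pulled out of both factors: `S_f` is an algebra over the field of
constants. -/
instance instIsScalarTower :
    IsScalarTower (constField δ) (PetitAlgebra f) (PetitAlgebra f) where
  smul_assoc a g h := by
    show mk f (toDiffPoly f ((a : K) • g) * toDiffPoly f h) =
      (a : K) • mk f (toDiffPoly f g * toDiffPoly f h)
    rw [map_smul, ← const_mul, mul_assoc, const_mul, map_smul]

instance instSMulCommClass :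
    SMulCommClass (constField δ) (PetitAlgebra f) (PetitAlgebra f) where
  smul_comm a g h := by
    show (a : K) • mk f (toDiffPoly f g * toDiffPoly f h) =
      mk f (toDiffPoly f g * toDiffPoly f ((a : K) • h))
    rw [map_smul, mul_smul_of_mem _ a.2, map_smul]

/-- The constant polynomials in `S_f`, that is, the copy of `K` in `S_f`. -/
def constants : Set (PetitAlgebra f) := {x | ∃ a : K, toDiffPoly f x = const δ a}

/-- The automorphism `σ` of `S_f` is the one induced by `G_{id, b}`. -/
def IsTranslation (b : K) (σ : RingAut (PetitAlgebra f)) : Prop :=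
  ∀ x : PetitAlgebra f, toDiffPoly f (σ x) = translate b (toDiffPoly f x)

end PetitAlgebra

/-! ### Nonassociative algebras -/

/-- A nonassociative ring `A ≠ 0` is a division algebra if the left and the right multiplication
with each nonzero element are bijective. -/
def IsDivisionAlg (A : Type*) [NonAssocRing A] : Prop :=
  Nontrivial A ∧ ∀ a : A, a ≠ 0 →
    Function.Bijective (fun x : A => a * x) ∧ Function.Bijective (fun x : A => x * a)

/-- The left nucleus `{x | [x, A, A] = 0}`. -/
def leftNucleus (A : Type*) [NonAssocRing A] : Set A := {x | ∀ y z : A, associator x y z = 0}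

/-- The middle nucleus `{x | [A, x, A] = 0}`. -/
def middleNucleus (A : Type*) [NonAssocRing A] : Set A := {x | ∀ y z : A, associator y x z = 0}

/-- The right nucleus `{x | [A, A, x] = 0}`. -/
def rightNucleus (A : Type*) [NonAssocRing A] : Set A := {x | ∀ y z : A, associator y z x = 0}

/-- The group `Aut_F(A)` of `F`-linear ring automorphisms of `A`. -/
def algAut (F A : Type*) [Field F] [NonAssocRing A] [Module F A] : Subgroup (RingAut A) where
  carrier := {σ | ∀ (a : F) (x : A), σ (a • x) = a • σ x}
  mul_mem' {σ τ} hσ hτ a x := by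
    show σ (τ (a • x)) = a • σ (τ x)
    rw [hτ, hσ]
  one_mem' _ _ := rfl
  inv_mem' {σ} hσ a x := by
    show σ.symm (a • x) = a • σ.symm x
    rw [RingEquiv.symm_apply_eq, hσ, RingEquiv.apply_symm_apply]

/-- The additive group `{δ(b)/b | b ∈ K, b ≠ 0}` of logarithmic derivatives. -/
def logDerivatives {K : Type*} [Field K] (δ : Derivation ℤ K K) : AddSubgroup K where
  carrier := {a | ∃ b : K, b ≠ 0 ∧ a = δ b / b}
  add_mem' := by
    rintro _ _ ⟨b, hb, rfl⟩ ⟨c, hc, rfl⟩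
    refine ⟨b * c, mul_ne_zero hb hc, ?_⟩
    rw [Derivation.leibniz]
    simp only [smul_eq_mul]
    field_simp
    ring
  zero_mem' := ⟨1, one_ne_zero, by simp⟩
  neg_mem' := by
    rintro _ ⟨b, hb, rfl⟩
    refine ⟨b⁻¹, inv_ne_zero hb, ?_⟩
    rw [Derivation.leibniz_inv]
    simp only [smul_eq_mul]
    field_simp

end

/-!
`K[t; δ]` is a domain in which the degree is additive on products, and its left ideals are
principal, so an irreducible `f` generates a maximal left ideal. If `g h = q f` with `h ≠ 0` of
degree less than `deg f`, then the multiples `r h` with `deg r < deg g` represent all of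
`K[t; δ] / K[t; δ] f`, which forces `deg f ≤ deg g`. Hence `S_f` has no zero divisors. Writing
`x y = q f + x ∘ y`, the associator `[x, y, z]` is `-q f z` modulo `f`. When
`deg x + deg y = deg f`, the quotient `q` is a nonzero element of `K`; so the right nucleus
consists of the `z` with `f z ≡ 0`, and the other two nuclei are `K` as soon as `S_f` is not
associative.

In characteristic `3` the commutator identities give `(t + b)³ = t³ + b³ + δ²(b)` and
`t³ a = a t³ + δ³(a)`. Therefore `t - a` divides `t³ - ct - V(a)` on both sides, and
`f = t³ - ct - d` is irreducible unless `d = V(a)` for some `a`, which is impossible because the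
values of `V` are constants. Since `f a = a f` and `f t = t f + δ(d)`, the right nucleus contains
`K` but not `t`.

The translation by `-a` fixes `f` exactly when `V(a) = 0`, that is, when `t - a` divides
`t³ - ct`. Let `K[t; δ]` act on `K` by differential operators, so that `t³ - ct` acts as zero. As
`t - δ(b)/b` kills `b`, the remainder `V(δ(b)/b)` of `t³ - ct` kills `b` too and is therefore
zero. Conversely, if `t³ - ct = (t - a) w`, then `w` does not act as zero, since an operator of
order `2` has a kernel of dimension at most `2` over `F`; and any nonzero value `b` of `w`
satisfies `δ(b) = a b`.
-/

/-! ### Commutators in characteristic `3` -/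

section CharThree

variable {R : Type*} [Ring R] [CharP R 3]

theorem add_pow_three_of_charThree (x y : R) :
    (x + y) ^ 3 = x ^ 3 + y ^ 3 + ⁅x, ⁅x, y⁆⁆ + ⁅y, ⁅y, x⁆⁆ := by
  have expansion : (x + y) ^ 3 =
      x ^ 3 + y ^ 3 + ⁅x, ⁅x, y⁆⁆ + ⁅y, ⁅y, x⁆⁆ + 3 * (x * y * x + y * x * y) := by
    simp only [Ring.lie_def]
    noncomm_ring
  have three_eq_zero : (3 : R) = 0 := by exact_mod_cast CharP.cast_eq_zero R 3
  rw [expansion, three_eq_zero, zero_mul, add_zero]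

theorem lie_pow_three_of_charThree (x y : R) : ⁅x ^ 3, y⁆ = ⁅x, ⁅x, ⁅x, y⁆⁆⁆ := by
  have expansion : ⁅x ^ 3, y⁆ = ⁅x, ⁅x, ⁅x, y⁆⁆⁆ + 3 * (x * x * y * x - x * y * x * x) := by
    simp only [Ring.lie_def]
    noncomm_ring
  have three_eq_zero : (3 : R) = 0 := by exact_mod_cast CharP.cast_eq_zero R 3
  rw [expansion, three_eq_zero, zero_mul, add_zero]

end CharThree

noncomputable section

/-! ### Linear algebra -/

universe u in
theorem rank_ker_comp_le {R : Type*} {M N : Type u} {P : Type*} [Ring R] [HasRankNullity.{u} R]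
    [AddCommGroup M] [Module R M] [AddCommGroup N] [Module R N] [AddCommGroup P] [Module R P]
    (S : N →ₗ[R] P) (T : M →ₗ[R] N) :
    Module.rank R (S ∘ₗ T).ker ≤ Module.rank R S.ker + Module.rank R T.ker := by
  let restriction : (S ∘ₗ T).ker →ₗ[R] S.ker := T.restrict fun _ hx => hx
  let kernel : restriction.ker →ₗ[R] T.ker :=
    ((S ∘ₗ T).ker.subtype ∘ₗ restriction.ker.subtype).codRestrict T.ker fun x =>
      congrArg Subtype.val x.2
  have kernel_injective : Function.Injective kernel := fun x y h =>
    Subtype.ext (Subtype.ext (congrArg ((↑) : T.ker → M) h))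
  rw [← restriction.rank_range_add_rank_ker]
  exact add_le_add (Submodule.rank_le _) (LinearMap.rank_le_of_injective kernel kernel_injective)

theorem isDivisionAlg_of_noZeroDivisors (F : Type*) {A : Type*} [DivisionRing F] [NonAssocRing A]
    [Module F A] [IsScalarTower F A A] [SMulCommClass F A A] [Module.Finite F A] [Nontrivial A]
    [NoZeroDivisors A] : IsDivisionAlg A := by
  refine ⟨inferInstance, fun a ha => ⟨?_, ?_⟩⟩
  · have h : Function.Injective (LinearMap.mulLeft F a) :=
      (injective_iff_map_eq_zero _).mpr fun x hx => (mul_eq_zero.mp hx).resolve_left ha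
    exact ⟨h, LinearMap.injective_iff_surjective.mp h⟩
  · have h : Function.Injective (LinearMap.mulRight F a) :=
      (injective_iff_map_eq_zero _).mpr fun x hx => (mul_eq_zero.mp hx).resolve_right ha
    exact ⟨h, LinearMap.injective_iff_surjective.mp h⟩

@[simp]
theorem derivationEnd_apply {K : Type*} [Field K] (δ : Derivation ℤ K K) (x : K) :
    derivationEnd δ x = δ x := rfl

namespace DiffPoly

variable {K : Type*} [Field K] {δ : Derivation ℤ K K}

/-! ### Degrees and units -/

/-- The degree in `t` of a differential polynomial, with the value `0` at the zero polynomial. -/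
def natDegree (p : DiffPoly δ) : ℕ := (toPoly δ p).natDegree

instance : NoZeroDivisors (DiffPoly δ) where
  eq_zero_or_eq_zero_of_mul_eq_zero {p q} hpq := by
    have h : (act δ (toPoly δ p) (toPoly δ q)).degree = ⊥ := degree_eq_bot.mpr hpq
    rw [degree_act, WithBot.add_eq_bot, degree_eq_bot, degree_eq_bot] at h
    exact h

instance : Nontrivial (DiffPoly δ) := inferInstanceAs (Nontrivial K[X])

instance : IsScalarTower K (DiffPoly δ) (DiffPoly δ) where
  smul_assoc a p q := by rw [smul_eq_mul, smul_eq_mul, ← const_mul, ← const_mul, mul_assoc]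

instance (p : ℕ) [CharP K p] : CharP (DiffPoly δ) p :=
  charP_of_injective_ringHom (const δ).injective p

theorem const_injective : Function.Injective (const δ) := (const δ).injective

theorem natDegree_mul {p q : DiffPoly δ} (hp : p ≠ 0) (hq : q ≠ 0) :
    (p * q).natDegree = p.natDegree + q.natDegree := by
  have h : (p * q).natDegree = _ :=
    congrArg (WithBot.unbotD 0) (degree_act (toPoly δ p) (toPoly δ q))
  rw [h, degree_eq_natDegree (p := toPoly δ p) hp, degree_eq_natDegree (p := toPoly δ q) hq]
  rfl

theorem ne_zero_of_natDegree_pos {p : DiffPoly δ} (hp : 0 < p.natDegree) : p ≠ 0 :=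
  Polynomial.ne_zero_of_natDegree_gt (p := toPoly δ p) hp

theorem natDegree_add_le (p q : DiffPoly δ) : (p + q).natDegree ≤ max p.natDegree q.natDegree :=
  Polynomial.natDegree_add_le (toPoly δ p) (toPoly δ q)

theorem natDegree_sub_le (p q : DiffPoly δ) : (p - q).natDegree ≤ max p.natDegree q.natDegree :=
  Polynomial.natDegree_sub_le (toPoly δ p) (toPoly δ q)

@[simp]
theorem natDegree_const (a : K) : (const δ a).natDegree = 0 := natDegree_C a

@[simp]
theorem natDegree_t : (t δ).natDegree = 1 := natDegree_X

theorem t_ne_zero : t δ ≠ 0 := Polynomial.X_ne_zero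

theorem eq_const_of_natDegree_eq_zero {p : DiffPoly δ} (hp : p.natDegree = 0) :
    ∃ a, p = const δ a := ⟨_, eq_C_of_natDegree_eq_zero hp⟩

theorem natDegree_pow (p : DiffPoly δ) (n : ℕ) : (p ^ n).natDegree = n * p.natDegree := by
  by_cases hp : p = 0
  · subst hp
    cases n with
    | zero => rw [pow_zero, zero_mul, ← map_one (const δ), natDegree_const]
    | succ n => rw [zero_pow n.succ_ne_zero, ← map_zero (const δ), natDegree_const, mul_zero]
  induction n with
  | zero => rw [pow_zero, zero_mul, ← map_one (const δ), natDegree_const]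
  | succ n ih => rw [pow_succ, natDegree_mul (pow_ne_zero n hp) hp, ih, Nat.succ_mul]

theorem isUnit_iff {p : DiffPoly δ} : IsUnit p ↔ p ≠ 0 ∧ p.natDegree = 0 := by
  constructor
  · intro hp
    obtain ⟨q, hpq⟩ := hp.exists_right_inv
    have hq : q ≠ 0 := right_ne_zero_of_mul_eq_one hpq
    have h := natDegree_mul hp.ne_zero hq
    rw [hpq, ← map_one (const δ), natDegree_const] at h
    exact ⟨hp.ne_zero, by omega⟩
  · rintro ⟨hp, hdeg⟩
    obtain ⟨a, rfl⟩ := eq_const_of_natDegree_eq_zero hdeg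
    exact (IsUnit.mk0 a ((map_ne_zero (const δ)).mp hp)).map (const δ)

theorem mem_lowDegree_iff {f p : DiffPoly δ} (hp : p ≠ 0) :
    p ∈ lowDegree f ↔ p.natDegree < f.natDegree :=
  mem_degreeLT.trans (natDegree_lt_iff_degree_lt (p := toPoly δ p) hp).symm

theorem natDegree_le_of_mem_lowDegree {f p : DiffPoly δ} (hp : p ∈ lowDegree f) :
    p.natDegree ≤ f.natDegree :=
  natDegree_le_of_degree_le (mem_degreeLT.mp hp).le

theorem exists_quotient_eq_const {f p q r : DiffPoly δ} (hp : p ≠ 0)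
    (hdeg : p.natDegree = f.natDegree) (hr : r ∈ lowDegree f) (h : p = q * f + r) :
    ∃ u, u ≠ 0 ∧ q = const δ u := by
  have quotient_mul_ne_zero : q * f ≠ 0 := fun h0 => by
    rw [h0, zero_add] at h
    exact ((mem_lowDegree_iff hp).mp (h ▸ hr)).ne hdeg
  have hq := left_ne_zero_of_mul quotient_mul_ne_zero
  have hle : (q * f).natDegree ≤ f.natDegree := by
    rw [← sub_eq_iff_eq_add.mpr h]
    exact (natDegree_sub_le p r).trans (max_le hdeg.le (natDegree_le_of_mem_lowDegree hr))
  rw [natDegree_mul hq (right_ne_zero_of_mul quotient_mul_ne_zero)] at hle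
  obtain ⟨u, rfl⟩ := eq_const_of_natDegree_eq_zero (p := q) (by omega)
  exact ⟨u, (map_ne_zero (const δ)).mp hq, rfl⟩

theorem natDegree_eq_zero_of_mul_eq_const {p q : DiffPoly δ} {a : K} (ha : a ≠ 0)
    (h : p * q = const δ a) : p.natDegree = 0 ∧ q.natDegree = 0 := by
  have hpq : p * q ≠ 0 := h ▸ (map_ne_zero (const δ)).mpr ha
  have hdeg := natDegree_mul (left_ne_zero_of_mul hpq) (right_ne_zero_of_mul hpq)
  rw [h, natDegree_const] at hdeg
  omega

theorem exists_eq_of_natDegree_eq_one {p : DiffPoly δ} (hp : p.natDegree = 1) :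
    ∃ u v, u ≠ 0 ∧ p = const δ u * t δ + const δ v := by
  obtain ⟨u, hu, v, huv⟩ := Polynomial.natDegree_eq_one.mp hp
  refine ⟨u, v, hu, ?_⟩
  rw [const_mul]
  exact huv.symm.trans (congrArg (· + C v) (smul_eq_C_mul u).symm)

theorem exists_eq_const_mul_t_sub_const {p : DiffPoly δ} (hp : p.natDegree = 1) :
    ∃ u a, p = const δ u * (t δ - const δ a) := by
  obtain ⟨u, v, hu, rfl⟩ := exists_eq_of_natDegree_eq_one hp
  refine ⟨u, -(v / u), ?_⟩
  rw [map_neg, sub_neg_eq_add, mul_add, ← map_mul, mul_div_cancel₀ v hu]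

theorem exists_eq_t_sub_const_mul_const {p : DiffPoly δ} (hp : p.natDegree = 1) :
    ∃ u a, p = (t δ - const δ a) * const δ u := by
  obtain ⟨u, v, hu, rfl⟩ := exists_eq_of_natDegree_eq_one hp
  refine ⟨u, (δ u - v) / u, ?_⟩
  rw [sub_mul, t_mul_const, ← map_mul, div_mul_cancel₀ _ hu, map_sub]
  abel

theorem natDegree_t_add_const (a : K) : (t δ + const δ a).natDegree = 1 :=
  natDegree_X_add_C a

theorem natDegree_t_sub_const (a : K) : (t δ - const δ a).natDegree = 1 :=
  natDegree_X_sub_C a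

theorem t_add_const_ne_zero (a : K) : t δ + const δ a ≠ 0 := X_add_C_ne_zero a

theorem t_sub_const_ne_zero (a : K) : t δ - const δ a ≠ 0 := X_sub_C_ne_zero a

theorem commute_t_const {c : K} (hc : δ c = 0) : Commute (t δ) (const δ c) := by
  rw [commute_iff_eq, t_mul_const, hc, map_zero, add_zero]

theorem lie_t_const (a : K) : ⁅t δ, const δ a⁆ = const δ (δ a) := by
  rw [Ring.lie_def, t_mul_const, add_sub_cancel_left]

theorem lie_const_const (a b : K) : ⁅const δ a, const δ b⁆ = 0 := by
  rw [Ring.lie_def, ← map_mul, ← map_mul, mul_comm, sub_self]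

/-! ### Left ideals -/

instance : IsPrincipalIdealRing (DiffPoly δ) where
  principal I := by
    by_cases hI : I = ⊥
    · exact ⟨0, by rw [hI, Submodule.span_zero_singleton]⟩
    obtain ⟨p, hpI, hp⟩ := Submodule.exists_mem_ne_zero_of_ne_bot hI
    let S := {n | ∃ f ∈ I, f ≠ 0 ∧ f.natDegree = n}
    obtain ⟨f, hfI, hf, hdeg⟩ : sInf S ∈ S := Nat.sInf_mem ⟨_, p, hpI, hp, rfl⟩
    refine ⟨f, le_antisymm (fun g hg => ?_) ((Ideal.span_singleton_le_iff_mem I).mpr hfI)⟩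
    obtain ⟨q, hq⟩ := modR_spec hf g
    have remainder_mem : (modR f g : DiffPoly δ) ∈ I := by
      rw [← sub_eq_iff_eq_add'.mpr hq]
      exact I.sub_mem hg (I.mul_mem_left q hfI)
    have remainder_eq_zero : (modR f g : DiffPoly δ) = 0 := by
      by_contra hr
      have hlt := (mem_lowDegree_iff hr).mp (modR f g).2
      exact hlt.not_ge (hdeg ▸ Nat.sInf_le ⟨_, remainder_mem, hr, rfl⟩)
    rw [remainder_eq_zero, add_zero] at hq
    exact Ideal.mem_span_singleton'.mpr ⟨q, hq.symm⟩

theorem isMaximal_span_singleton_of_irreducible {f : DiffPoly δ} (hf : Irreducible f) :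
    (Ideal.span {f}).IsMaximal := by
  refine Ideal.isMaximal_def.mpr ⟨fun h => ?_, fun I hI => ?_⟩
  · obtain ⟨q, hq⟩ := Ideal.mem_span_singleton'.mp ((Ideal.eq_top_iff_one _).mp h)
    have hdeg := natDegree_eq_zero_of_mul_eq_const one_ne_zero (hq.trans (map_one (const δ)).symm)
    exact hf.not_isUnit (isUnit_iff.mpr ⟨hf.ne_zero, hdeg.2⟩)
  obtain ⟨g, rfl⟩ := (IsPrincipalIdealRing.principal I).principal
  obtain ⟨q, hq⟩ := Ideal.mem_span_singleton'.mp (hI.le (Ideal.mem_span_singleton_self f))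
  refine (hf.isUnit_or_isUnit hq.symm).elim (fun hunit => ?_) (fun hunit => ?_)
  · obtain ⟨u, rfl⟩ := hunit
    refine absurd ((Ideal.span_singleton_le_iff_mem _).mpr ?_) hI.not_ge
    exact Ideal.mem_span_singleton'.mpr ⟨↑u⁻¹, by rw [← hq, Units.inv_mul_cancel_left]⟩
  · exact Ideal.eq_top_of_isUnit_mem _ (Ideal.mem_span_singleton_self g) hunit

/-! ### The universal property -/

section Lift

variable {R : Type*} [Semiring R]

/-- The ring homomorphism `∑ aᵢ tⁱ ↦ ∑ φ(aᵢ) uⁱ` out of `K[t; δ]` determined by a homomorphism `φ`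
on `K` and an image `u` of `t` that satisfies the defining relation `t a = a t + δ a`. -/
def lift (φ : K →+* R) (u : R) (hu : ∀ a, u * φ a = φ a * u + φ (δ a)) : DiffPoly δ →+* R where
  toFun p := (toPoly δ p).eval₂ φ u
  map_zero' := eval₂_zero φ u
  map_add' _ _ := eval₂_add φ u
  map_one' := eval₂_one φ u
  map_mul' p q := by
    have eval₂_tMul (q : K[X]) : (tMul δ q).eval₂ φ u = u * q.eval₂ φ u := by
      induction q using Polynomial.induction_on' with
      | add p q hp hq => rw [map_add, eval₂_add, hp, hq, eval₂_add, mul_add]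
      | monomial i a =>
        rw [tMul_monomial, eval₂_add, eval₂_monomial, eval₂_monomial, eval₂_monomial, ← mul_assoc,
          hu, add_mul, mul_assoc, pow_succ']
    have eval₂_tMul_pow (i : ℕ) (q : K[X]) :
        ((tMul δ ^ i : AddMonoid.End K[X]) q).eval₂ φ u = u ^ i * q.eval₂ φ u := by
      induction i with
      | zero => rw [pow_zero, pow_zero, one_mul, AddMonoid.End.coe_one, id_eq]
      | succ i ih => rw [pow_succ', end_mul_apply, eval₂_tMul, ih, pow_succ', mul_assoc]
    have eval₂_C_mul (a : K) (q : K[X]) : (C a * q).eval₂ φ u = φ a * q.eval₂ φ u := by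
      rw [C_mul', eval₂_smul]
    change (act δ (toPoly δ p) (toPoly δ q)).eval₂ φ u = _
    induction toPoly δ p using Polynomial.induction_on' with
    | add p r hp hr => rw [act_add, end_add_apply, eval₂_add, hp, hr, eval₂_add, add_mul]
    | monomial i a =>
      rw [act_monomial, end_mul_apply, coeffMul_apply, eval₂_C_mul, eval₂_tMul_pow, eval₂_monomial,
        mul_assoc]

variable {φ : K →+* R} {u : R} {hu : ∀ a, u * φ a = φ a * u + φ (δ a)}

@[simp]
theorem lift_const (a : K) : lift φ u hu (const δ a) = φ a := eval₂_C φ u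

@[simp]
theorem lift_t : lift φ u hu (t δ) = u := eval₂_X φ u

@[ext]
theorem hom_ext {φ ψ : DiffPoly δ →+* R} (hconst : ∀ a, φ (const δ a) = ψ (const δ a))
    (ht : φ (t δ) = ψ (t δ)) : φ = ψ := by
  refine RingHom.ext fun p => ?_
  rw [eq_sum p, Polynomial.sum, map_sum, map_sum]
  exact Finset.sum_congr rfl fun i _ => by rw [map_mul, map_mul, map_pow, map_pow, hconst, ht]

end Lift

/-! ### Translations -/

/-- The map `G_{id, b}` of `DiffPoly.translate`, as an endomorphism of the ring `K[t; δ]`. -/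
def translateHom (b : K) : DiffPoly δ →+* DiffPoly δ :=
  lift (const δ) (t δ + const δ b) fun a => by
    rw [add_mul, t_mul_const, mul_add, ← map_mul (const δ) b a, mul_comm b a, map_mul]
    abel

theorem translateHom_apply (b : K) (p : DiffPoly δ) : translateHom b p = translate b p :=
  (toPoly δ p).eval₂_eq_sum

@[simp]
theorem translateHom_const (b a : K) : translateHom b (const δ a) = const δ a := lift_const a

@[simp]
theorem translateHom_t (b : K) : translateHom b (t δ) = t δ + const δ b := lift_t

theorem translate_zero (p : DiffPoly δ) : translate 0 p = p := by
  have h : translateHom (δ := δ) 0 = RingHom.id _ := by ext <;> simp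
  rw [← translateHom_apply, h, RingHom.id_apply]

theorem translate_translate (a b : K) (p : DiffPoly δ) :
    translate a (translate b p) = translate (a + b) p := by
  have h : (translateHom a).comp (translateHom b) = translateHom (δ := δ) (a + b) := by
    ext <;> simp [add_assoc]
  rw [← translateHom_apply, ← translateHom_apply, ← translateHom_apply, ← h, RingHom.comp_apply]

theorem translate_mem_lowDegree {f p : DiffPoly δ} (b : K) (hp : p ∈ lowDegree f) :
    translate b p ∈ lowDegree f := by
  refine Submodule.sum_mem _ fun i hi => ?_
  have hconst : const δ ((toPoly δ p).coeff i) ≠ 0 :=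
    (map_ne_zero (const δ)).mpr (Polynomial.mem_support_iff.mp hi)
  have hpow : (t δ + const δ b) ^ i ≠ 0 := pow_ne_zero i (t_add_const_ne_zero b)
  rw [mem_lowDegree_iff (mul_ne_zero hconst hpow), natDegree_mul hconst hpow, natDegree_const,
    natDegree_pow, natDegree_t_add_const, zero_add, mul_one]
  exact Nat.cast_lt.mp ((le_degree_of_mem_supp i hi).trans_lt (mem_degreeLT.mp hp))

theorem translate_mul (b : K) (p q : DiffPoly δ) :
    translate b (p * q) = translate b p * translate b q := by
  simp only [← translateHom_apply, map_mul]

theorem translate_add (b : K) (p q : DiffPoly δ) :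
    translate b (p + q) = translate b p + translate b q := by
  simp only [← translateHom_apply, map_add]

theorem translate_neg_translate (b : K) (p : DiffPoly δ) :
    translate (-b) (translate b p) = p := by
  rw [translate_translate, neg_add_cancel, translate_zero]

theorem translate_t (b : K) : translate b (t δ) = t δ + const δ b := by
  rw [← translateHom_apply, translateHom_t]

theorem translate_const (b a : K) : translate b (const δ a) = const δ a := by
  rw [← translateHom_apply, translateHom_const]

theorem translate_neg_t (a : K) : translate (-a) (t δ) = t δ - const δ a := by
  rw [translate_t, map_neg, sub_eq_add_neg]

/-- The additive group of those `b ∈ K` for which `G_{id, b}` fixes `f`; these are the translations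
of `K[t; δ]` that induce an automorphism of `S_f`. -/
def translationStabilizer (f : DiffPoly δ) : AddSubgroup K where
  carrier := {b | translate b f = f}
  add_mem' {a b} (ha : translate a f = f) (hb : translate b f = f) :=
    (translate_translate a b f).symm.trans (hb.symm ▸ ha)
  zero_mem' := translate_zero f
  neg_mem' {b} (hb : translate b f = f) := by
    have h := translate_neg_translate b f
    rwa [hb] at h

theorem mem_translationStabilizer {f : DiffPoly δ} {b : K} :
    b ∈ translationStabilizer f ↔ translate b f = f := Iff.rfl

/-! ### The action on `K` by differential operators -/

variable (δ) in
/-- The action of `K[t; δ]` on `K` by differential operators: `t` acts as `δ` and the constants act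
by multiplication. -/
def toEnd : DiffPoly δ →+* Module.End (constField δ) K :=
  lift (Algebra.lmul (constField δ) K).toRingHom (derivationEnd δ) fun a => by
    ext x
    change δ (a * x) = a * δ x + δ a * x
    rw [Derivation.leibniz, smul_eq_mul, smul_eq_mul, mul_comm x]

@[simp]
theorem toEnd_const_apply (a x : K) : toEnd δ (const δ a) x = a * x := by
  rw [toEnd, lift_const]
  rfl

@[simp]
theorem toEnd_t : toEnd δ (t δ) = derivationEnd δ := lift_t

theorem toEnd_t_sub_const_apply (a x : K) : toEnd δ (t δ - const δ a) x = δ x - a * x := by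
  rw [map_sub, LinearMap.sub_apply, toEnd_t, derivationEnd_apply, toEnd_const_apply]

theorem toEnd_ofPoly_map (p : (constField δ)[X]) :
    toEnd δ (ofPoly δ (p.map (algebraMap (constField δ) K))) = aeval (derivationEnd δ) p :=
  eval₂_map ..

theorem exists_eq_mul_t_sub_const_add_const (p : DiffPoly δ) (a : K) :
    ∃ q r, p = q * (t δ - const δ a) + const δ r := by
  obtain ⟨q, hq⟩ := modR_spec (t_sub_const_ne_zero a) p
  generalize modR (t δ - const δ a) p = R at hq
  have hdeg : (R : DiffPoly δ).natDegree = 0 := by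
    by_cases h : (R : DiffPoly δ) = 0
    · rw [h, ← map_zero (const δ), natDegree_const]
    · have := (mem_lowDegree_iff h).mp R.2
      rwa [natDegree_t_sub_const, Nat.lt_one_iff] at this
  obtain ⟨r, hr⟩ := eq_const_of_natDegree_eq_zero hdeg
  exact ⟨q, r, hr ▸ hq⟩

theorem toEnd_t_sub_const_div_self {y : K} (hy : y ≠ 0) :
    toEnd δ (t δ - const δ (δ y / y)) y = 0 := by
  rw [toEnd_t_sub_const_apply, div_mul_cancel₀ _ hy, sub_self]

theorem exists_eq_mul_of_toEnd_apply_eq_zero {p : DiffPoly δ} {y : K} (hy : y ≠ 0)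
    (h : toEnd δ p y = 0) : ∃ q, p = q * (t δ - const δ (δ y / y)) := by
  obtain ⟨q, r, rfl⟩ := exists_eq_mul_t_sub_const_add_const p (δ y / y)
  rw [map_add, map_mul, LinearMap.add_apply, Module.End.mul_apply, toEnd_t_sub_const_div_self hy,
    map_zero, zero_add, toEnd_const_apply] at h
  have hr : r = 0 := (mul_eq_zero.mp h).resolve_right hy
  exact ⟨q, by rw [hr, map_zero, add_zero]⟩

theorem rank_ker_toEnd_t_sub_const_le (a : K) :
    Module.rank (constField δ) (toEnd δ (t δ - const δ a)).ker ≤ 1 := by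
  rw [rank_submodule_le_one_iff']
  by_cases h : ∃ y, y ≠ 0 ∧ toEnd δ (t δ - const δ a) y = 0
  · obtain ⟨y, hy, hya⟩ := h
    refine ⟨y, fun x hx => Submodule.mem_span_singleton.mpr ?_⟩
    rw [LinearMap.mem_ker] at hx
    rw [toEnd_t_sub_const_apply, sub_eq_zero] at hx hya
    have hconst : δ (x / y) = 0 := by
      rw [Derivation.leibniz_div, hx, hya, smul_eq_mul, smul_eq_mul, smul_eq_mul]
      ring
    exact ⟨⟨x / y, hconst⟩, div_mul_cancel₀ x hy⟩
  · push Not at h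
    refine ⟨0, fun x hx => ?_⟩
    rw [Submodule.span_zero_singleton, Submodule.mem_bot]
    by_contra hx0
    exact h x hx0 hx

theorem rank_ker_toEnd_le {p : DiffPoly δ} (hp : p ≠ 0) :
    Module.rank (constField δ) (toEnd δ p).ker ≤ p.natDegree := by
  induction hn : p.natDegree generalizing p with
  | zero =>
    obtain ⟨a, rfl⟩ := eq_const_of_natDegree_eq_zero hn
    have hker : (toEnd δ (const δ a)).ker = ⊥ := by
      refine LinearMap.ker_eq_bot'.mpr fun x hx => ?_
      rw [toEnd_const_apply] at hx
      exact (mul_eq_zero.mp hx).resolve_left ((map_ne_zero (const δ)).mp hp)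
    rw [hker, rank_bot, Nat.cast_zero]
  | succ n ih =>
    by_cases hker : (toEnd δ p).ker = ⊥
    · rw [hker, rank_bot]
      exact zero_le
    obtain ⟨y, hpy, hy⟩ := Submodule.exists_mem_ne_zero_of_ne_bot hker
    obtain ⟨q, rfl⟩ := exists_eq_mul_of_toEnd_apply_eq_zero hy hpy
    have hq : q ≠ 0 := left_ne_zero_of_mul hp
    rw [natDegree_mul hq (t_sub_const_ne_zero _), natDegree_t_sub_const, Nat.succ_inj] at hn
    rw [map_mul, Nat.cast_succ]
    exact (rank_ker_comp_le _ _).trans (add_le_add (ih hq hn) (rank_ker_toEnd_t_sub_const_le _))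

theorem rank_constField_le_natDegree {p : DiffPoly δ} (hp : p ≠ 0) (h : toEnd δ p = 0) :
    Module.rank (constField δ) K ≤ p.natDegree := by
  have hker := rank_ker_toEnd_le hp
  rwa [h, LinearMap.ker_zero, rank_top] at hker

theorem finite_constField_of_toEnd_eq_zero {p : DiffPoly δ} (hp : p ≠ 0) (h : toEnd δ p = 0) :
    Module.Finite (constField δ) K :=
  Module.rank_lt_aleph0_iff.mp
    ((rank_constField_le_natDegree hp h).trans_lt Cardinal.natCast_lt_aleph0)

theorem finrank_constField_eq_natDegree_minpoly (h : IsIntegral (constField δ) (derivationEnd δ)) :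
    Module.finrank (constField δ) K = (minpoly (constField δ) (derivationEnd δ)).natDegree := by
  set P := (minpoly (constField δ) (derivationEnd δ)).map (algebraMap (constField δ) K)
  have hmonic : P.Monic := (minpoly.monic h).map _
  have hP0 : ofPoly δ P ≠ 0 := hmonic.ne_zero
  have hPend : toEnd δ (ofPoly δ P) = 0 := by rw [toEnd_ofPoly_map, minpoly.aeval]
  have := finite_constField_of_toEnd_eq_zero hP0 hPend
  refine le_antisymm ?_ ?_
  · rw [← (minpoly.monic h).natDegree_map (algebraMap (constField δ) K)]
    exact Module.finrank_le_of_rank_le (rank_constField_le_natDegree hP0 hPend)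
  · rw [← LinearMap.charpoly_natDegree (derivationEnd δ)]
    exact natDegree_le_of_dvd (LinearMap.minpoly_dvd_charpoly _)
      (LinearMap.charpoly_monic _).ne_zero

end DiffPoly

namespace PetitAlgebra

open DiffPoly

variable {K : Type*} [Field K] {δ : Derivation ℤ K K} {f : DiffPoly δ}

/-! ### The nuclei of a Petit algebra -/

theorem toDiffPoly_injective : Function.Injective (toDiffPoly f) := Subtype.val_injective

theorem toDiffPoly_mem (x : PetitAlgebra f) : toDiffPoly f x ∈ lowDegree f := x.2

theorem toDiffPoly_mk {p : DiffPoly δ} (hp : p ∈ lowDegree f) : toDiffPoly f (mk f p) = p :=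
  congrArg (toDiffPoly f) (modR_coe ⟨p, hp⟩)

theorem toDiffPoly_ne_zero {x : PetitAlgebra f} (hx : x ≠ 0) : toDiffPoly f x ≠ 0 :=
  (map_ne_zero_iff _ toDiffPoly_injective).mpr hx

theorem natDegree_toDiffPoly_lt {x : PetitAlgebra f} (hx : x ≠ 0) :
    (toDiffPoly f x).natDegree < f.natDegree :=
  (mem_lowDegree_iff (toDiffPoly_ne_zero hx)).mp (toDiffPoly_mem x)

theorem exists_eq_mul_add_mk (hf : f ≠ 0) (p : DiffPoly δ) :
    ∃ q, p = q * f + toDiffPoly f (mk f p) := modR_spec hf p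

theorem mk_mul_self (hf : f ≠ 0) (q : DiffPoly δ) : mk f (q * f) = 0 :=
  modR_eq hf (add_zero (q * f)).symm

theorem mk_mul_mk (hf : f ≠ 0) (p q : DiffPoly δ) :
    mk f (p * toDiffPoly f (mk f q)) = mk f (p * q) := by
  obtain ⟨s, hs⟩ := exists_eq_mul_add_mk hf q
  conv_rhs => rw [hs, mul_add, ← mul_assoc, map_add, mk_mul_self hf, zero_add]

theorem mk_mul_eq_zero (hf : f ≠ 0) (p : DiffPoly δ) {q : DiffPoly δ} (hq : mk f q = 0) :
    mk f (p * q) = 0 := by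
  rw [← mk_mul_mk hf, hq, map_zero, mul_zero, map_zero]

theorem associator_eq_neg_mk (hf : f ≠ 0) {x y : PetitAlgebra f} {q : DiffPoly δ}
    (h : toDiffPoly f x * toDiffPoly f y = q * f + toDiffPoly f (x * y)) (z : PetitAlgebra f) :
    associator x y z = -mk f (q * (f * toDiffPoly f z)) := by
  have right_assoc : x * (y * z) = mk f (toDiffPoly f x * toDiffPoly f y * toDiffPoly f z) := by
    rw [mul_def, mul_def, mk_mul_mk hf, mul_assoc]
  rw [associator_apply, right_assoc, h, mul_def, add_mul, map_add, mul_assoc, sub_add_cancel_right]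

theorem associator_eq_zero_of_mk_mul_eq_zero (hf : f ≠ 0) (x y : PetitAlgebra f)
    {z : PetitAlgebra f} (hz : mk f (f * toDiffPoly f z) = 0) : associator x y z = 0 := by
  obtain ⟨q, hq⟩ := exists_eq_mul_add_mk hf (toDiffPoly f x * toDiffPoly f y)
  rw [associator_eq_neg_mk hf hq, mk_mul_eq_zero hf q hz, neg_zero]

theorem associator_eq_zero_of_mul_mem_lowDegree (hf : f ≠ 0) {x y : PetitAlgebra f}
    (h : toDiffPoly f x * toDiffPoly f y ∈ lowDegree f) (z : PetitAlgebra f) :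
    associator x y z = 0 := by
  have product_eq : toDiffPoly f x * toDiffPoly f y = 0 * f + toDiffPoly f (x * y) := by
    rw [zero_mul, zero_add, mul_def, toDiffPoly_mk h]
  rw [associator_eq_neg_mk hf product_eq, zero_mul, map_zero, neg_zero]

theorem mk_mul_eq_zero_of_associator_eq_zero {x y z : PetitAlgebra f} (hx : x ≠ 0) (hy : y ≠ 0)
    (hdeg : (toDiffPoly f x).natDegree + (toDiffPoly f y).natDegree = f.natDegree)
    (h : associator x y z = 0) : mk f (f * toDiffPoly f z) = 0 := by
  have hf : f ≠ 0 :=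
    ne_zero_of_natDegree_pos ((Nat.zero_le _).trans_lt (natDegree_toDiffPoly_lt hx))
  have natDegree_product : (toDiffPoly f x * toDiffPoly f y).natDegree = f.natDegree := by
    rw [DiffPoly.natDegree_mul (toDiffPoly_ne_zero hx) (toDiffPoly_ne_zero hy), hdeg]
  obtain ⟨q, hq⟩ := exists_eq_mul_add_mk hf (toDiffPoly f x * toDiffPoly f y)
  obtain ⟨u, hu, rfl⟩ := exists_quotient_eq_const
    (mul_ne_zero (toDiffPoly_ne_zero hx) (toDiffPoly_ne_zero hy)) natDegree_product
    (toDiffPoly_mem _) hq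
  rw [associator_eq_neg_mk hf hq, neg_eq_zero, const_mul, map_smul] at h
  exact (smul_eq_zero.mp h).resolve_left hu

theorem t_pow_mem_lowDegree {n : ℕ} (hn : n < f.natDegree) : t δ ^ n ∈ lowDegree f := by
  rwa [mem_lowDegree_iff (pow_ne_zero n t_ne_zero), DiffPoly.natDegree_pow, natDegree_t, mul_one]

theorem mk_t_pow_ne_zero {n : ℕ} (hn : n < f.natDegree) : mk f (t δ ^ n) ≠ 0 := by
  intro h
  have ht := toDiffPoly_mk (t_pow_mem_lowDegree hn)
  rw [h, map_zero] at ht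
  exact pow_ne_zero n t_ne_zero ht.symm

theorem natDegree_toDiffPoly_mk_t_pow {n : ℕ} (hn : n < f.natDegree) :
    (toDiffPoly f (mk f (t δ ^ n))).natDegree = n := by
  rw [toDiffPoly_mk (t_pow_mem_lowDegree hn), DiffPoly.natDegree_pow, natDegree_t, mul_one]

theorem ne_zero_of_notMem_constants {x : PetitAlgebra f} (hx : x ∉ constants f) : x ≠ 0 := by
  rintro rfl
  exact hx ⟨0, by rw [map_zero, map_zero]⟩

theorem exists_natDegree_add_eq_natDegree {x : PetitAlgebra f} (hx : x ∉ constants f) :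
    ∃ y : PetitAlgebra f, y ≠ 0 ∧
      (toDiffPoly f x).natDegree + (toDiffPoly f y).natDegree = f.natDegree := by
  have natDegree_lt := natDegree_toDiffPoly_lt (ne_zero_of_notMem_constants hx)
  have natDegree_ne_zero : (toDiffPoly f x).natDegree ≠ 0 := fun h =>
    hx (eq_const_of_natDegree_eq_zero h)
  have complement_lt : f.natDegree - (toDiffPoly f x).natDegree < f.natDegree := by omega
  refine ⟨mk f (t δ ^ _), mk_t_pow_ne_zero complement_lt, ?_⟩
  rw [natDegree_toDiffPoly_mk_t_pow complement_lt]
  omega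

theorem mk_mul_eq_zero_of_notMem_constants {x z : PetitAlgebra f} (hx : x ∉ constants f)
    (h : ∀ y, associator x y z = 0 ∨ associator y x z = 0) : mk f (f * toDiffPoly f z) = 0 := by
  have hx0 := ne_zero_of_notMem_constants hx
  obtain ⟨y, hy, hdeg⟩ := exists_natDegree_add_eq_natDegree hx
  obtain hxy | hyx := h y
  · exact mk_mul_eq_zero_of_associator_eq_zero hx0 hy hdeg hxy
  · exact mk_mul_eq_zero_of_associator_eq_zero hy hx0 ((add_comm _ _).trans hdeg) hyx

theorem mem_rightNucleus_iff (hf : 2 ≤ f.natDegree) {z : PetitAlgebra f} :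
    z ∈ rightNucleus (PetitAlgebra f) ↔ mk f (f * toDiffPoly f z) = 0 := by
  refine ⟨fun hz => ?_, fun hz x y => associator_eq_zero_of_mk_mul_eq_zero
    (ne_zero_of_natDegree_pos (by omega)) x y hz⟩
  have mk_t_notMem : mk f (t δ ^ 1) ∉ constants f := by
    rintro ⟨a, ha⟩
    have hdeg := natDegree_toDiffPoly_mk_t_pow (f := f) (n := 1) (by omega)
    rw [ha, natDegree_const] at hdeg
    exact zero_ne_one hdeg
  exact mk_mul_eq_zero_of_notMem_constants mk_t_notMem fun y => .inl (hz _ y)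

theorem constants_subset_leftNucleus (hf : f ≠ 0) :
    constants f ⊆ leftNucleus (PetitAlgebra f) := by
  rintro x ⟨a, ha⟩ y z
  refine associator_eq_zero_of_mul_mem_lowDegree hf ?_ z
  rw [ha, const_mul]
  exact Submodule.smul_mem _ a (toDiffPoly_mem y)

theorem mul_const_mem_lowDegree {p : DiffPoly δ} (hp : p ∈ lowDegree f) (a : K) :
    p * const δ a ∈ lowDegree f := by
  by_cases h : p * const δ a = 0
  · rw [h]
    exact zero_mem _
  have hp0 := left_ne_zero_of_mul h
  rw [mem_lowDegree_iff h, natDegree_mul hp0 (right_ne_zero_of_mul h), natDegree_const, add_zero]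
  exact (mem_lowDegree_iff hp0).mp hp

theorem constants_subset_middleNucleus (hf : f ≠ 0) :
    constants f ⊆ middleNucleus (PetitAlgebra f) := by
  rintro x ⟨a, ha⟩ y z
  refine associator_eq_zero_of_mul_mem_lowDegree hf ?_ z
  rw [ha]
  exact mul_const_mem_lowDegree (toDiffPoly_mem y) a

theorem mem_constants_of_associator_eq_zero (hf : f ≠ 0)
    (not_assoc : ¬∀ x y z : PetitAlgebra f, x * y * z = x * (y * z)) {x : PetitAlgebra f}
    (h : ∀ y z, associator x y z = 0 ∨ associator y x z = 0) : x ∈ constants f := by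
  by_contra hx
  refine not_assoc fun u v z => sub_eq_zero.mp (associator_eq_zero_of_mk_mul_eq_zero hf u v ?_)
  exact mk_mul_eq_zero_of_notMem_constants hx fun y => h y z

theorem leftNucleus_eq_constants (hf : f ≠ 0)
    (not_assoc : ¬∀ x y z : PetitAlgebra f, x * y * z = x * (y * z)) :
    leftNucleus (PetitAlgebra f) = constants f :=
  (constants_subset_leftNucleus hf).antisymm' fun _ hx =>
    mem_constants_of_associator_eq_zero hf not_assoc fun y z => .inl (hx y z)

theorem middleNucleus_eq_constants (hf : f ≠ 0)
    (not_assoc : ¬∀ x y z : PetitAlgebra f, x * y * z = x * (y * z)) :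
    middleNucleus (PetitAlgebra f) = constants f :=
  (constants_subset_middleNucleus hf).antisymm' fun _ hx =>
    mem_constants_of_associator_eq_zero hf not_assoc fun y z => .inr (hx y z)

/-! ### Petit division algebras -/

variable (f) in
/-- The powers `1, t, …, t ^ (m - 1)`, `m = deg f`, as a basis of `S_f` over `K`. -/
def tPowBasis : Module.Basis (Fin f.natDegree) K (PetitAlgebra f) := degreeLT.basis K f.natDegree

instance : Module.Finite K (PetitAlgebra f) := Module.Finite.of_basis (tPowBasis f)

theorem finrank_eq_natDegree (f : DiffPoly δ) :
    Module.finrank K (PetitAlgebra f) = f.natDegree := by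
  rw [Module.finrank_eq_card_basis (tPowBasis f), Fintype.card_fin]

theorem finrank_constField (f : DiffPoly δ) :
    Module.finrank (constField δ) (PetitAlgebra f) =
      Module.finrank (constField δ) K * f.natDegree := by
  rw [← Module.finrank_mul_finrank (constField δ) K, finrank_eq_natDegree]

theorem natDegree_le_of_mul_eq_mul {g h q : DiffPoly δ} (hf : f ≠ 0) (hg : g ≠ 0)
    (comaximal : Ideal.span {f} ⊔ Ideal.span {h} = ⊤) (hgh : g * h = q * f) :
    f.natDegree ≤ g.natDegree := by
  let mulRightMod : PetitAlgebra g →ₗ[K] PetitAlgebra f :=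
    mk f ∘ₗ LinearMap.mulRight K h ∘ₗ toDiffPoly g
  have surjective : Function.Surjective mulRightMod := fun s => by
    obtain ⟨a, b, hb, hab⟩ :=
      Ideal.mem_span_singleton_sup.mp ((Ideal.eq_top_iff_one _).mp comaximal)
    obtain ⟨b, rfl⟩ := Ideal.mem_span_singleton'.mp hb
    obtain ⟨u, hu⟩ := exists_eq_mul_add_mk hg (toDiffPoly f s * b)
    refine ⟨mk g (toDiffPoly f s * b), ?_⟩
    calc mk f (toDiffPoly g (mk g (toDiffPoly f s * b)) * h)
        = mk f (toDiffPoly f s * b * h - u * q * f) := by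
          rw [← sub_eq_iff_eq_add'.mpr hu, sub_mul, mul_assoc u g h, hgh, ← mul_assoc]
      _ = mk f (toDiffPoly f s * a * f + toDiffPoly f s * b * h) := by
          rw [map_sub, map_add, mk_mul_self hf, mk_mul_self hf, sub_zero, zero_add]
      _ = s := by rw [mul_assoc, mul_assoc, ← mul_add, hab, mul_one, mk_toDiffPoly]
  have hrank := LinearMap.finrank_le_finrank_of_surjective surjective
  rwa [finrank_eq_natDegree, finrank_eq_natDegree] at hrank

theorem noZeroDivisors_of_irreducible (hf : Irreducible f) : NoZeroDivisors (PetitAlgebra f) where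
  eq_zero_or_eq_zero_of_mul_eq_zero {g h} hgh := by
    by_contra! hne
    obtain ⟨q, hq⟩ := exists_eq_mul_add_mk hf.ne_zero (toDiffPoly f g * toDiffPoly f h)
    rw [← mul_def, hgh, map_zero, add_zero] at hq
    have notMem : toDiffPoly f h ∉ Ideal.span {f} := fun hmem => by
      obtain ⟨s, hs⟩ := Ideal.mem_span_singleton'.mp hmem
      have hs0 : s = 0 := eq_zero_of_mul_mem hf.ne_zero (hs ▸ toDiffPoly_mem h)
      rw [hs0, zero_mul] at hs
      exact toDiffPoly_ne_zero hne.2 hs.symm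
    have comaximal : Ideal.span {f} ⊔ Ideal.span {toDiffPoly f h} = ⊤ := by
      refine (Ideal.isMaximal_def.mp (isMaximal_span_singleton_of_irreducible hf)).2 _ ?_
      exact left_lt_sup.mpr fun hle => notMem ((Ideal.span_singleton_le_iff_mem _).mp hle)
    exact (natDegree_le_of_mul_eq_mul hf.ne_zero (toDiffPoly_ne_zero hne.1) comaximal hq).not_gt
      (natDegree_toDiffPoly_lt hne.1)

theorem isDivisionAlg_of_irreducible [Module.Finite (constField δ) K] (hf : Irreducible f) :
    IsDivisionAlg (PetitAlgebra f) := by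
  have natDegree_pos : 0 < f.natDegree := Nat.pos_of_ne_zero fun h =>
    hf.not_isUnit (isUnit_iff.mpr ⟨hf.ne_zero, h⟩)
  have : Nontrivial (PetitAlgebra f) := ⟨_, 0, mk_t_pow_ne_zero natDegree_pos⟩
  have := noZeroDivisors_of_irreducible hf
  have : Module.Finite (constField δ) (PetitAlgebra f) := Module.Finite.trans K _
  exact isDivisionAlg_of_noZeroDivisors (constField δ)

/-! ### Automorphisms induced by translations -/

theorem toDiffPoly_mk_translate (b : K) (x : PetitAlgebra f) :
    toDiffPoly f (mk f (translate b (toDiffPoly f x))) = translate b (toDiffPoly f x) :=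
  toDiffPoly_mk (translate_mem_lowDegree b (toDiffPoly_mem x))

theorem mk_translate_toDiffPoly_mk (hf : f ≠ 0) {b : K} (hb : b ∈ translationStabilizer f)
    (p : DiffPoly δ) : mk f (translate b (toDiffPoly f (mk f p))) = mk f (translate b p) := by
  obtain ⟨q, hq⟩ := exists_eq_mul_add_mk hf p
  conv_rhs => rw [hq, DiffPoly.translate_add, translate_mul, mem_translationStabilizer.mp hb,
    map_add, mk_mul_self hf, zero_add]

/-- The automorphism of the ring `S_f` induced by a translation `G_{id, b}` that fixes `f`. -/
def translationAut (hf : f ≠ 0) (b : translationStabilizer f) : RingAut (PetitAlgebra f) where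
  toFun x := mk f (translate b (toDiffPoly f x))
  invFun x := mk f (translate (-b) (toDiffPoly f x))
  left_inv x := by
    simp only [toDiffPoly_mk_translate, translate_neg_translate, mk_toDiffPoly]
  right_inv x := by
    have h := translate_neg_translate (-(b : K)) (toDiffPoly f x)
    rw [neg_neg] at h
    simp only [toDiffPoly_mk_translate, h, mk_toDiffPoly]
  map_add' x y := by rw [map_add, DiffPoly.translate_add, map_add]
  map_mul' x y := by
    rw [mul_def, mk_translate_toDiffPoly_mk hf b.2, translate_mul, mul_def,
      toDiffPoly_mk_translate, toDiffPoly_mk_translate]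

theorem isTranslation_translationAut (hf : f ≠ 0) (b : translationStabilizer f) :
    IsTranslation f b (translationAut hf b) := toDiffPoly_mk_translate (b : K)

theorem IsTranslation.unique {b : K} {σ τ : RingAut (PetitAlgebra f)}
    (hσ : IsTranslation f b σ) (hτ : IsTranslation f b τ) : σ = τ :=
  RingEquiv.ext fun x => toDiffPoly_injective ((hσ x).trans (hτ x).symm)

theorem IsTranslation.mul {a b : K} {σ τ : RingAut (PetitAlgebra f)}
    (hσ : IsTranslation f a σ) (hτ : IsTranslation f b τ) : IsTranslation f (a + b) (σ * τ) :=
  fun x => by rw [RingAut.mul_apply, hσ, hτ, DiffPoly.translate_translate]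

theorem IsTranslation.one : IsTranslation f 0 (1 : RingAut (PetitAlgebra f)) :=
  fun x => (translate_zero (toDiffPoly f x)).symm

theorem IsTranslation.parameter_unique (hf : 2 ≤ f.natDegree) {a b : K}
    {σ : RingAut (PetitAlgebra f)} (ha : IsTranslation f a σ) (hb : IsTranslation f b σ) :
    a = b := by
  have t_mem : t δ ∈ lowDegree f := (mem_lowDegree_iff t_ne_zero).mpr (natDegree_t.trans_lt hf)
  have h := (ha (mk f (t δ))).symm.trans (hb (mk f (t δ)))
  rw [toDiffPoly_mk t_mem, translate_t, translate_t] at h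
  exact const_injective (add_left_cancel h)

theorem IsTranslation.mem_algAut {b : K} {σ : RingAut (PetitAlgebra f)}
    (hσ : IsTranslation f b σ) : σ ∈ algAut (constField δ) (PetitAlgebra f) := fun a x => by
  apply toDiffPoly_injective
  have toDiffPoly_smul (y : PetitAlgebra f) :
      toDiffPoly f (a • y) = const δ (a : K) * toDiffPoly f y :=
    (map_smul (toDiffPoly f) (a : K) y).trans (const_mul _ _).symm
  rw [hσ, toDiffPoly_smul, toDiffPoly_smul, hσ, translate_mul, translate_const]

/-- The homomorphism `a ↦ G_{id, -a}` into `Aut_F(S_f)`, `F` the field of constants, on the group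
of those `a` for which this translation fixes `f`. -/
def translationHom (hf : f ≠ 0) : Multiplicative (translationStabilizer f) →*
    algAut (constField δ) (PetitAlgebra f) where
  toFun a := ⟨translationAut hf (-a.toAdd), (isTranslation_translationAut hf _).mem_algAut⟩
  map_one' := Subtype.ext <| (isTranslation_translationAut hf _).unique <| by
    simpa using IsTranslation.one
  map_mul' a b := Subtype.ext <| (isTranslation_translationAut hf _).unique <| by
    simpa [add_comm] using (isTranslation_translationAut hf (-a.toAdd)).mul
      (isTranslation_translationAut hf (-b.toAdd))

theorem isTranslation_translationHom (hf : f ≠ 0) (a : translationStabilizer f) :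
    IsTranslation f (-(a : K)) (translationHom hf (.ofAdd a)) :=
  isTranslation_translationAut hf (-a)

theorem translationHom_injective (hf : 2 ≤ f.natDegree) :
    Function.Injective (translationHom (ne_zero_of_natDegree_pos (two_pos.trans_le hf))) :=
  fun a b hab => Multiplicative.toAdd.injective <| Subtype.ext <| neg_injective <|
    (isTranslation_translationHom _ a.toAdd).parameter_unique hf <|
      hab ▸ isTranslation_translationHom _ b.toAdd

theorem mem_range_translationHom (hf : f ≠ 0) {σ : algAut (constField δ) (PetitAlgebra f)} :
    σ ∈ (translationHom hf).range ↔
      ∃ a ∈ translationStabilizer f, IsTranslation f (-a) (σ : RingAut (PetitAlgebra f)) := by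
  constructor
  · rintro ⟨a, rfl⟩
    exact ⟨_, a.toAdd.2, isTranslation_translationHom hf a.toAdd⟩
  · rintro ⟨a, ha, hσ⟩
    exact ⟨.ofAdd ⟨a, ha⟩, Subtype.ext ((isTranslation_translationHom hf ⟨a, ha⟩).unique hσ)⟩

end PetitAlgebra

/-! ### The cubics `t³ - ct - d` -/

namespace DiffPoly

variable {K : Type*} [Field K] {δ : Derivation ℤ K K}

variable (δ) in
/-- The differential polynomial `t³ - ct - d`. -/
def cubic (c d : K) : DiffPoly δ := t δ ^ 3 - const δ c * t δ - const δ d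

theorem cubic_eq_cubic_add_const (c d e : K) : cubic δ c d = cubic δ c e + const δ (e - d) := by
  rw [cubic, cubic, map_sub]
  abel

theorem natDegree_cubic (c d : K) : (cubic δ c d).natDegree = 3 := by
  have remainder_degree : (const δ c * t δ + const δ d).natDegree < (t δ ^ 3).natDegree := by
    rw [DiffPoly.natDegree_pow, natDegree_t, const_mul]
    refine (natDegree_add_le _ _).trans_lt (max_lt ?_ ?_)
    · exact ((natDegree_smul_le c (X : K[X])).trans natDegree_X_le).trans_lt (by norm_num)
    · rw [natDegree_const]; norm_num
  have h : (t δ ^ 3 - (const δ c * t δ + const δ d)).natDegree = (t δ ^ 3).natDegree :=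
    natDegree_sub_eq_left_of_natDegree_lt remainder_degree
  rw [cubic, sub_sub, h, DiffPoly.natDegree_pow, natDegree_t]

theorem cubic_ne_zero (c d : K) : cubic δ c d ≠ 0 :=
  ne_zero_of_natDegree_pos (by rw [natDegree_cubic]; norm_num)

theorem cubic_zero_eq_mul_t (c : K) : cubic δ c 0 = (t δ ^ 2 - const δ c) * t δ := by
  rw [cubic, map_zero, sub_zero, sub_mul, pow_succ]

theorem cubic_zero_eq_t_mul {c : K} (hc : δ c = 0) :
    cubic δ c 0 = t δ * (t δ ^ 2 - const δ c) := by
  rw [cubic, map_zero, sub_zero, mul_sub, (commute_t_const hc).eq, pow_succ']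

theorem toEnd_cubic_apply (c d x : K) :
    toEnd δ (cubic δ c d) x = δ (δ (δ x)) - c * δ x - d * x := by
  rw [cubic, map_sub, map_sub, map_mul, LinearMap.sub_apply, LinearMap.sub_apply,
    Module.End.mul_apply, toEnd_const_apply, toEnd_const_apply, map_pow, toEnd_t]
  rfl

theorem cubic_mul_t {c : K} (hc : δ c = 0) (d : K) :
    cubic δ c d * t δ = t δ * cubic δ c d + const δ (δ d) := by
  have cubic_zero_comm : cubic δ c 0 * t δ = t δ * cubic δ c 0 := by
    rw [cubic_zero_eq_t_mul hc, mul_assoc, ← cubic_zero_eq_mul_t, cubic_zero_eq_t_mul hc]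
  rw [cubic_eq_cubic_add_const c d 0, add_mul, mul_add, cubic_zero_comm, t_mul_const, zero_sub,
    map_neg δ, map_neg (const δ) (δ d)]
  abel

theorem toEnd_cubic_zero (c : constField δ) :
    toEnd δ (cubic δ c 0) = aeval (derivationEnd δ) (X ^ 3 - C c * X) := by
  rw [cubic, map_zero, sub_zero, map_sub, map_sub, map_mul, map_mul, map_pow, map_pow, toEnd_t,
    aeval_X, aeval_C]
  congr 2
  ext x
  exact toEnd_const_apply _ x

theorem toEnd_cubic_zero_eq_zero {c : constField δ}
    (h : minpoly (constField δ) (derivationEnd δ) = X ^ 3 - C c * X) :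
    toEnd δ (cubic δ c 0) = 0 := by
  rw [toEnd_cubic_zero, ← h, minpoly.aeval]

theorem finrank_constField_eq_three {c : constField δ}
    (h : minpoly (constField δ) (derivationEnd δ) = X ^ 3 - C c * X) :
    Module.finrank (constField δ) K = 3 := by
  have hdeg : (X ^ 3 - C c * X).natDegree = 3 := by compute_degree!
  have integral : IsIntegral (constField δ) (derivationEnd δ) :=
    minpoly.ne_zero_iff.mp (h ▸ ne_zero_of_natDegree_gt (hdeg ▸ three_pos))
  rw [finrank_constField_eq_natDegree_minpoly integral, h, hdeg]

section CharThree

variable [CharP K 3]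

theorem cubic_mul_const (c d a : K) :
    cubic δ c d * const δ a = const δ a * cubic δ c d + const δ (toEnd δ (cubic δ c 0) a) := by
  have t_cubed : t δ ^ 3 * const δ a = const δ a * t δ ^ 3 + const δ (δ (δ (δ a))) := by
    rw [← sub_eq_iff_eq_add', ← Ring.lie_def, lie_pow_three_of_charThree, lie_t_const,
      lie_t_const, lie_t_const]
  have const_comm (x y : K) : const δ x * const δ y = const δ y * const δ x := by
    rw [← map_mul, mul_comm, map_mul]
  rw [toEnd_cubic_apply, zero_mul, sub_zero, cubic, sub_mul, sub_mul, t_cubed, const_comm d,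
    mul_assoc, t_mul_const, mul_add, mul_sub, mul_sub, ← mul_assoc, const_comm c, mul_assoc,
    ← map_mul, map_sub]
  abel

variable (δ) in
/-- The additive map `a ↦ a³ + δ²(a) - ca` on `K`, denoted `V` in the paper. The translation
`G_{id, b}` takes `t³ - ct - d` to `t³ - ct - (d - V b)`. -/
def cubicShift (c : K) : K →+ K where
  toFun a := a ^ 3 + δ (δ a) - c * a
  map_zero' := by simp
  map_add' a b := by
    rw [add_pow_char, map_add, map_add, mul_add]
    abel

theorem cubicShift_apply (c a : K) : cubicShift δ c a = a ^ 3 + δ (δ a) - c * a := rfl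

theorem t_add_const_pow_three (b : K) :
    (t δ + const δ b) ^ 3 = t δ ^ 3 + const δ (b ^ 3 + δ (δ b)) := by
  have lie_const_t : ⁅const δ b, t δ⁆ = const δ (-δ b) := by
    rw [Ring.lie_def, t_mul_const, map_neg]
    abel
  rw [add_pow_three_of_charThree, lie_t_const, lie_t_const, lie_const_t, lie_const_const, add_zero,
    map_add, map_pow, add_assoc]

theorem translate_cubic (b c d : K) :
    translate b (cubic δ c d) = cubic δ c (d - cubicShift δ c b) := by
  rw [← translateHom_apply, cubic, map_sub, map_sub, map_mul, map_pow, translateHom_t,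
    translateHom_const, translateHom_const, t_add_const_pow_three, cubic, cubicShift_apply]
  simp only [mul_add, map_add, map_sub, map_mul]
  abel

theorem translationStabilizer_cubic (c d : K) :
    translationStabilizer (cubic δ c d) = (cubicShift δ c).ker := by
  ext b
  rw [mem_translationStabilizer, translate_cubic, cubic_eq_cubic_add_const c _ d, add_eq_left,
    sub_sub_cancel, map_eq_zero, AddMonoidHom.mem_ker]

theorem cubic_eq_translate_neg (c a : K) :
    cubic δ c (cubicShift δ c a) = translate (-a) (cubic δ c 0) := by
  rw [translate_cubic, map_neg, zero_sub, neg_neg]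

theorem cubic_cubicShift_eq_mul_t_sub_const (c a : K) :
    cubic δ c (cubicShift δ c a) = translate (-a) (t δ ^ 2 - const δ c) * (t δ - const δ a) := by
  rw [cubic_eq_translate_neg, cubic_zero_eq_mul_t, translate_mul, translate_neg_t]

theorem cubic_cubicShift_eq_t_sub_const_mul {c : K} (hc : δ c = 0) (a : K) :
    cubic δ c (cubicShift δ c a) = (t δ - const δ a) * translate (-a) (t δ ^ 2 - const δ c) := by
  rw [cubic_eq_translate_neg, cubic_zero_eq_t_mul hc, translate_mul, translate_neg_t]

theorem cubic_ne_mul_t_sub_const {c d a : K} (h : cubicShift δ c a ≠ d) (q : DiffPoly δ) :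
    cubic δ c d ≠ q * (t δ - const δ a) := fun hq => by
  have hfactor : (q - translate (-a) (t δ ^ 2 - const δ c)) * (t δ - const δ a) =
      const δ (cubicShift δ c a - d) := by
    rw [sub_mul, ← hq, ← cubic_cubicShift_eq_mul_t_sub_const, cubic_eq_cubic_add_const c d,
      add_sub_cancel_left]
  have := (natDegree_eq_zero_of_mul_eq_const (sub_ne_zero.mpr h) hfactor).2
  rw [natDegree_t_sub_const] at this
  exact one_ne_zero this

theorem cubic_ne_t_sub_const_mul {c d a : K} (hc : δ c = 0) (h : cubicShift δ c a ≠ d)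
    (q : DiffPoly δ) : cubic δ c d ≠ (t δ - const δ a) * q := fun hq => by
  have hfactor : (t δ - const δ a) * (q - translate (-a) (t δ ^ 2 - const δ c)) =
      const δ (cubicShift δ c a - d) := by
    rw [mul_sub, ← hq, ← cubic_cubicShift_eq_t_sub_const_mul hc, cubic_eq_cubic_add_const c d,
      add_sub_cancel_left]
  have := (natDegree_eq_zero_of_mul_eq_const (sub_ne_zero.mpr h) hfactor).1
  rw [natDegree_t_sub_const] at this
  exact one_ne_zero this

theorem irreducible_cubic {c d : K} (hc : δ c = 0) (h : ∀ a, cubicShift δ c a ≠ d) :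
    Irreducible (cubic δ c d) where
  not_isUnit hunit := by
    have := (isUnit_iff.mp hunit).2
    rw [natDegree_cubic] at this
    exact three_ne_zero this
  isUnit_or_isUnit {p q} hpq := by
    have hpq0 : p * q ≠ 0 := hpq ▸ cubic_ne_zero c d
    have hp := left_ne_zero_of_mul hpq0
    have hq := right_ne_zero_of_mul hpq0
    have hdeg := natDegree_mul hp hq
    rw [← hpq, natDegree_cubic] at hdeg
    rw [isUnit_iff, isUnit_iff]
    have natDegree_left : p.natDegree ≠ 1 := fun hp1 => by
      obtain ⟨u, a, rfl⟩ := exists_eq_t_sub_const_mul_const hp1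
      exact cubic_ne_t_sub_const_mul hc (h a) _ (hpq.trans (mul_assoc _ _ _))
    have natDegree_right : q.natDegree ≠ 1 := fun hq1 => by
      obtain ⟨u, a, rfl⟩ := exists_eq_const_mul_t_sub_const hq1
      exact cubic_ne_mul_t_sub_const (h a) _ (hpq.trans (mul_assoc _ _ _).symm)
    by_cases hp0 : p.natDegree = 0
    · exact .inl ⟨hp, hp0⟩
    · exact .inr ⟨hq, by omega⟩

theorem cubicShift_mem_constField {c : K} (hc : δ c = 0) (h : toEnd δ (cubic δ c 0) = 0) (a : K) :
    cubicShift δ c a ∈ constField δ := by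
  have h_apply : δ (δ (δ a)) - c * δ a - 0 * a = 0 := by
    rw [← toEnd_cubic_apply, h, LinearMap.zero_apply]
  have der_cube : δ (a ^ 3) = 0 := by
    rw [Derivation.leibniz_pow, nsmul_eq_mul, CharP.cast_eq_zero K 3, zero_mul]
  change δ (a ^ 3 + δ (δ a) - c * a) = 0
  rw [map_sub, map_add, der_cube, Derivation.leibniz, hc]
  simpa using h_apply

theorem logDerivatives_le_ker_cubicShift {c : K} (h : toEnd δ (cubic δ c 0) = 0) :
    logDerivatives δ ≤ (cubicShift δ c).ker := by
  rintro _ ⟨b, hb, rfl⟩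
  have hzero : toEnd δ (cubic δ c (cubicShift δ c (δ b / b))) b = 0 := by
    rw [cubic_cubicShift_eq_mul_t_sub_const, map_mul, Module.End.mul_apply,
      toEnd_t_sub_const_div_self hb, map_zero]
  rw [cubic_eq_cubic_add_const c _ 0, map_add, h, zero_add, toEnd_const_apply, zero_sub] at hzero
  exact neg_eq_zero.mp ((mul_eq_zero.mp hzero).resolve_right hb)

theorem ker_cubicShift_le_logDerivatives {c : K} (hc : δ c = 0) (h : toEnd δ (cubic δ c 0) = 0)
    (hdim : 3 ≤ Module.finrank (constField δ) K) : (cubicShift δ c).ker ≤ logDerivatives δ := by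
  intro a (ha : cubicShift δ c a = 0)
  set w := translate (-a) (t δ ^ 2 - const δ c) with hw
  have right_factor : w * (t δ - const δ a) = cubic δ c 0 := by
    rw [hw, ← cubic_cubicShift_eq_mul_t_sub_const, ha]
  have left_factor : (t δ - const δ a) * w = cubic δ c 0 := by
    rw [hw, ← cubic_cubicShift_eq_t_sub_const_mul hc, ha]
  have w_ne_zero : w ≠ 0 := left_ne_zero_of_mul (right_factor ▸ cubic_ne_zero c 0)
  have natDegree_w : w.natDegree + 1 = 3 := by
    rw [← natDegree_t_sub_const (δ := δ) a, ← natDegree_mul w_ne_zero (t_sub_const_ne_zero a),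
      right_factor, natDegree_cubic]
  obtain ⟨y, hy⟩ : ∃ y, toEnd δ w y ≠ 0 := by
    by_contra! hzero
    have := Module.finrank_le_of_rank_le
      (rank_constField_le_natDegree w_ne_zero (LinearMap.ext hzero))
    omega
  have root : toEnd δ (t δ - const δ a) (toEnd δ w y) = 0 := by
    rw [← Module.End.mul_apply, ← map_mul, left_factor, h, LinearMap.zero_apply]
  rw [toEnd_t_sub_const_apply, sub_eq_zero] at root
  exact ⟨toEnd δ w y, hy, (eq_div_iff hy).mpr root.symm⟩

theorem logDerivatives_eq_ker_cubicShift {c : constField δ}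
    (h : minpoly (constField δ) (derivationEnd δ) = X ^ 3 - C c * X) :
    logDerivatives δ = (cubicShift δ c).ker :=
  have annihilates := toEnd_cubic_zero_eq_zero h
  (logDerivatives_le_ker_cubicShift annihilates).antisymm
    (ker_cubicShift_le_logDerivatives c.2 annihilates (finrank_constField_eq_three h).ge)

end CharThree

end DiffPoly

namespace PetitAlgebra

open DiffPoly

variable {K : Type*} [Field K] {δ : Derivation ℤ K K}

theorem two_le_natDegree_cubic (c d : K) : 2 ≤ (cubic δ c d).natDegree := by
  rw [DiffPoly.natDegree_cubic]
  norm_num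

theorem not_assoc_cubic {c d : K} (hc : δ c = 0) (hd : δ d ≠ 0) :
    ¬∀ x y z : PetitAlgebra (cubic δ c d), x * y * z = x * (y * z) := fun assoc => by
  have t_mem : t δ ∈ lowDegree (cubic δ c d) := by
    rw [mem_lowDegree_iff t_ne_zero, natDegree_t, DiffPoly.natDegree_cubic]
    norm_num
  have const_mem : const δ (δ d) ∈ lowDegree (cubic δ c d) := by
    rw [mem_lowDegree_iff ((map_ne_zero (const δ)).mpr hd), natDegree_const,
      DiffPoly.natDegree_cubic]
    norm_num
  have h := (mem_rightNucleus_iff (two_le_natDegree_cubic c d)).mp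
    fun x y => sub_eq_zero.mpr (assoc x y (mk _ (t δ)))
  rw [toDiffPoly_mk t_mem, cubic_mul_t hc, map_add, mk_mul_self (cubic_ne_zero c d), zero_add] at h
  have hzero := toDiffPoly_mk const_mem
  rw [h, map_zero] at hzero
  exact hd ((map_eq_zero (const δ)).mp hzero.symm)

theorem constants_subset_rightNucleus_cubic [CharP K 3] {c : K} (h : toEnd δ (cubic δ c 0) = 0)
    (d : K) : constants (cubic δ c d) ⊆ rightNucleus (PetitAlgebra (cubic δ c d)) := by
  rintro x ⟨a, ha⟩
  rw [mem_rightNucleus_iff (two_le_natDegree_cubic c d), ha, cubic_mul_const, h,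
    LinearMap.zero_apply, map_zero, add_zero, mk_mul_self (cubic_ne_zero c d)]

end PetitAlgebra

end

theorem mainTheorem6 {K : Type*} [Field K] [CharP K 3] (δ : Derivation ℤ K K)
    (c : constField δ)
    (hδ : minpoly (constField δ) (derivationEnd δ) = X ^ 3 - C c * X)
    (d : K) (hd : d ∉ constField δ)
    (f : DiffPoly δ)
    (hf : f = DiffPoly.t δ ^ 3 - DiffPoly.const δ c * DiffPoly.t δ - DiffPoly.const δ d) :
    Module.finrank (constField δ) (PetitAlgebra f) = 9 ∧
    (¬ ∀ x y z : PetitAlgebra f, x * y * z = x * (y * z)) ∧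
    IsDivisionAlg (PetitAlgebra f) ∧
    leftNucleus (PetitAlgebra f) = PetitAlgebra.constants f ∧
    middleNucleus (PetitAlgebra f) = PetitAlgebra.constants f ∧
    PetitAlgebra.constants f ⊆ rightNucleus (PetitAlgebra f) ∧
    (logDerivatives δ : Set K) = {a | a ^ 3 + δ (δ a) - c * a = 0} ∧
    (∀ a : K, a ^ 3 + δ (δ a) - c * a = 0 →
      ∃ σ : algAut (constField δ) (PetitAlgebra f), PetitAlgebra.IsTranslation f (-a) σ) ∧
    ∃ H : Subgroup (algAut (constField δ) (PetitAlgebra f)),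
      (∀ σ : algAut (constField δ) (PetitAlgebra f), σ ∈ H ↔
        ∃ a : K, a ^ 3 + δ (δ a) - c * a = 0 ∧ PetitAlgebra.IsTranslation f (-a) σ) ∧
      ∃ φ : Multiplicative (logDerivatives δ) ≃* H, ∀ a : logDerivatives δ,
        PetitAlgebra.IsTranslation f (-(a : K))
          (φ (Multiplicative.ofAdd a) : algAut (constField δ) (PetitAlgebra f)) := by
  obtain rfl : f = DiffPoly.cubic δ c d := hf
  have annihilates := DiffPoly.toEnd_cubic_zero_eq_zero hδ
  have := DiffPoly.finite_constField_of_toEnd_eq_zero (DiffPoly.cubic_ne_zero (c : K) 0) annihilates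
  have hf0 := DiffPoly.cubic_ne_zero (δ := δ) (c : K) d
  have not_assoc := PetitAlgebra.not_assoc_cubic c.2 hd
  have irreducible := DiffPoly.irreducible_cubic c.2 fun a =>
    ne_of_mem_of_not_mem (DiffPoly.cubicShift_mem_constField c.2 annihilates a) hd
  have logDerivatives_eq := DiffPoly.logDerivatives_eq_ker_cubicShift hδ
  have stabilizer_eq := DiffPoly.translationStabilizer_cubic (δ := δ) (c : K) d
  let equiv := AddEquiv.addSubgroupCongr (logDerivatives_eq.trans stabilizer_eq.symm)
  have injective := PetitAlgebra.translationHom_injective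
    (PetitAlgebra.two_le_natDegree_cubic (δ := δ) (c : K) d)
  refine ⟨?_, not_assoc, PetitAlgebra.isDivisionAlg_of_irreducible irreducible,
    PetitAlgebra.leftNucleus_eq_constants hf0 not_assoc,
    PetitAlgebra.middleNucleus_eq_constants hf0 not_assoc,
    PetitAlgebra.constants_subset_rightNucleus_cubic annihilates d,
    congrArg SetLike.coe logDerivatives_eq,
    fun a ha => ⟨_, PetitAlgebra.isTranslation_translationHom hf0 ⟨a, stabilizer_eq ▸ ha⟩⟩,
    (PetitAlgebra.translationHom hf0).range, fun σ => ?_,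
    equiv.toMultiplicative.trans (MonoidHom.ofInjective injective),
    fun a => PetitAlgebra.isTranslation_translationHom hf0 (equiv a)⟩
  · rw [PetitAlgebra.finrank_constField, DiffPoly.finrank_constField_eq_three hδ,
      DiffPoly.natDegree_cubic]
  · rw [PetitAlgebra.mem_range_translationHom, stabilizer_eq]
    rfl
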